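/- Let $a_1,\dots,a_6\in\mathbb{C}$ and, for $\lambda\in\mathbb{C}$, let $$D=x^2(x-1)^2\frac{d^3}{dx^3}+x(x-1)(a_1+a_2x)\frac{d^2}{dx^2}+(a_3+a_4x+a_5x^2)\frac{d}{dx}+a_6x+\lambda .$$ Let $b_1,b_2,c_1,c_2,c_3\in\mathbb{C}$ be such that $$b_1+b_2=-a_1-1,\quad b_1b_2=a_3,\quad c_1+c_2+c_3=a_2-3,$$ $$c_1c_2+c_1c_3+c_2c_3=a_5-a_2+2,\quad c_1c_2c_3=a_6,$$ and suppose that neither $b_1$ nor $b_2$ is one of $0,-1,-2,\dots$. Then for every $\lambda$ there is exactly one function $f_\lambda$ (as a germ at $0$) that is analytic near $x=0$ and satisfies $Df_\lambda=0$, $f_\lambda(0)=1$. Moreover $f_\lambda(x)=\sum_{i\ge 0}P_i(\lambda)x^i$ near $0$, where the $P_i$ are polynomials with $\deg P_i=i$ and $P_0=1$, so that $P_0,P_1,\dots$ is a basis of $\mathbb{C}[\lambda]$. Define $C_{i,j}^k\in\mathbb{C}$ by $P_iP_j=\sum_{k}C_{i,j}^kP_k$, and let $$K(x_1,x_2,y)=\sum_{i,j,k\ge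 0}C_{i,j}^k\frac{x_1^ix_2^j}{y^{k+1}} .$$ Then $$K(x_1,x_2,y)=\sum_{\substack{i\ge 0,\\ 0\le j\le k\le i+j}}\frac{(-1)^j\,k!}{j!\,(k-j)!\,(i+j-k)!}\cdot\frac{(x_1x_2)^i\big((x_1-1)(x_2-1)\big)^j}{(y-1)^{k+1}}$$ $$\times\prod_{l=j+1}^{k}\big(b_1b_2+c_1c_2+c_1c_3+c_2c_3+a_4+l(c_1+c_2+c_3)+(1-l)(b_1+b_2)+l^2-l+1\big)\cdot\frac{\prod_{l=k}^{i+j-1}(c_1+l)(c_2+l)(c_3+l)}{\prod_{l=0}^{i-1}(b_1+l)(b_2+l)} .$$ This is an identity of formal series in nonnegative powers of $x_1,x_2$ and negative powers of $y$: each $1/(y-1)^{k+1}$ is expanded in powers of $1/y$, each monomial $x_1^px_2^qy^{-m}$ then occurs in only finitely many terms of the right-hand side, and its coefficients there add up to its coefficient in $K$. -/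

import Mathlib

open Polynomial Topology

noncomputable section

namespace ThirdOrderKernel

/-- The third order operator
`D = x²(x-1)² ∂³ + x(x-1)(a₁ + a₂x) ∂² + (a₃ + a₄x + a₅x²) ∂ + a₆x + lam`
applied to `f : ℂ → ℂ` at the point `x`. -/
def diffOp (a₁ a₂ a₃ a₄ a₅ a₆ lam : ℂ) (f : ℂ → ℂ) (x : ℂ) : ℂ :=
  x ^ 2 * (x - 1) ^ 2 * iteratedDeriv 3 f x
    + x * (x - 1) * (a₁ + a₂ * x) * iteratedDeriv 2 f x
    + (a₃ + a₄ * x + a₅ * x ^ 2) * deriv f x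
    + (a₆ * x + lam) * f x

/-- `f` is analytic near `0`, `f 0 = 1`, and `D f = 0` near `0`. -/
structure IsNormalizedSolution (a₁ a₂ a₃ a₄ a₅ a₆ lam : ℂ) (f : ℂ → ℂ) : Prop where
  analyticAt : AnalyticAt ℂ f 0
  map_zero : f 0 = 1
  diffOp_eq_zero : ∀ᶠ x in 𝓝 (0 : ℂ), diffOp a₁ a₂ a₃ a₄ a₅ a₆ lam f x = 0

/-- Structure constants of polynomial multiplication in the basis `P`: the coefficient
`C_{i,j}^k` in `P i * P j = ∑ k, C_{i,j}^k • P k`. -/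
def structureConst (P : Module.Basis ℕ ℂ ℂ[X]) (i j k : ℕ) : ℂ :=
  P.repr (P i * P j) k

/-- The ring `ℂ((1/y))[[x₁, x₂]]`; the Laurent variable of the coefficient field is `1/y`. -/
abbrev KernelRing : Type := MvPowerSeries (Fin 2) (LaurentSeries ℂ)

/-- The element `y` of `ℂ((1/y))`, that is, the Laurent variable to the power `-1`. -/
def yVar : LaurentSeries ℂ := HahnSeries.single (-1 : ℤ) (1 : ℂ)

/-- The variable `x₁`. -/
def x₁ : KernelRing := MvPowerSeries.X 0

/-- The variable `x₂`. -/
def x₂ : KernelRing := MvPowerSeries.X 1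

/-- The generating function `∑_{i,j,k} C_{i,j}^k x₁^i x₂^j / y^(k+1)`: its coefficient at
`x₁^i x₂^j` is `∑ k, C_{i,j}^k / y^(k+1)`, a sum over the finitely many `k` with
`C_{i,j}^k ≠ 0`. -/
def kernel (P : Module.Basis ℕ ℂ ℂ[X]) : KernelRing := fun d =>
  ∑ k ∈ (P.repr (P (d 0) * P (d 1))).support,
    HahnSeries.C (structureConst P (d 0) (d 1) k) * (yVar ^ (k + 1))⁻¹

/-- `s` is the sum of the family `t` of formal series in `x₁, x₂, 1/y`: at every monomial
`x₁^(d 0) x₂^(d 1) y^(-m)` only finitely many members of the family have a nonzero coefficient,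
and these coefficients add up to that of `s`. -/
def IsFormalSum {ι : Type} (t : ι → KernelRing) (s : KernelRing) : Prop :=
  ∀ (d : Fin 2 →₀ ℕ) (m : ℤ),
    {i | (MvPowerSeries.coeff d (t i)).coeff m ≠ 0}.Finite ∧
      ∑ᶠ i, (MvPowerSeries.coeff d (t i)).coeff m = (MvPowerSeries.coeff d s).coeff m

/-- The numerical coefficient of the triple sum (used for `j ≤ k ≤ i + j`). -/
def tripleCoeff (b₁ b₂ c₁ c₂ c₃ a₄ : ℂ) (i j k : ℕ) : ℂ :=
  (-1) ^ j * (k.factorial : ℂ)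
      / ((j.factorial : ℂ) * ((k - j).factorial : ℂ) * ((i + j - k).factorial : ℂ))
    * (∏ l ∈ Finset.Icc (j + 1) k,
        (b₁ * b₂ + c₁ * c₂ + c₁ * c₃ + c₂ * c₃ + a₄ + (l : ℂ) * (c₁ + c₂ + c₃)
          + (1 - (l : ℂ)) * (b₁ + b₂) + (l : ℂ) ^ 2 - (l : ℂ) + 1))
    * ((∏ l ∈ Finset.Ico k (i + j), (c₁ + (l : ℂ)) * (c₂ + (l : ℂ)) * (c₃ + (l : ℂ)))
        / (∏ l ∈ Finset.range i, (b₁ + (l : ℂ)) * (b₂ + (l : ℂ))))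

/-- The index set of the triple sum: `(i, j, k)` with `j ≤ k ≤ i + j`. -/
abbrev TripleIndex : Type :=
  {t : ℕ × ℕ × ℕ // t.2.1 ≤ t.2.2 ∧ t.2.2 ≤ t.1 + t.2.1}

/-- The `(i, j, k)` term of the triple sum. -/
def tripleTerm (b₁ b₂ c₁ c₂ c₃ a₄ : ℂ) (i j k : ℕ) : KernelRing :=
  MvPowerSeries.C (HahnSeries.C (tripleCoeff b₁ b₂ c₁ c₂ c₃ a₄ i j k) / (yVar - 1) ^ (k + 1))
    * (x₁ * x₂) ^ i * ((x₁ - 1) * (x₂ - 1)) ^ j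

end ThirdOrderKernel

end

open Polynomial Topology

noncomputable section

namespace ThirdOrderKernel


/-! ### Contiguity relations of the triple-sum coefficients. -/

section Coefficients

/-! On powers of x the operator D is tridiagonal: it lowers with n β(n-1), keeps with q(n) and
raises with γ(n), where β has roots -b₁, -b₂ and γ has roots -c₁, -c₂, -c₃. So D f = 0 is a
three-term recurrence for the Taylor coefficients. As β never vanishes on ℕ, it is solved by
polynomials P_n(λ) of degree n (`recPoly`). Since (n+1)‖β(n)‖ grows at least cubically while q + λ
and γ grow at most cubically, solutions are geometrically bounded, hence convergent
(`exists_norm_le_pow`). The recurrence also gives uniqueness.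

The same recurrence says that multiplication by λ has, in the basis P, minus the transposed
tridiagonal matrix. Computing λ P_p P_s through the first factor and through the product gives: D
acting in p on C_{p,s}^n equals the transpose of D acting in n (`seqOp_structureConst`). With
C_{0,s}^n = δ_{ns} this determines all C, because the coefficient of row p+1 is nonzero
(`eq_of_seqOp_eq_seqOpAdj`). It remains to verify the same equation and initial row for the triple
sum.

Expanding 1/(y-1)^(k+1) turns the sum over k into a binomial transform (`binomSum`). The binomial
matrix is the change of basis from powers of x to powers of x-1, where D is again tridiagonal, with
symbols φ, q' and the same γ (`seqOpAdj_choose`); this removes the shift in y. On x^i (x-1)^j, D has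
four terms (`formalOp_X_pow_mul`). Applied in x₁ to the sum over u = x₁x₂ and v = (x₁-1)(x₂-1),
these produce x₁ and x₂ with equal coefficients, thanks to `tripleSeq_left_add_right`, and x₁ + x₂ =
u - v + 1 returns everything to monomials in u, v (`seqOp_fullSum`). What is left is a relation
between neighbouring coefficients (`opTriple_balance`), which contiguity relations reduce to a
polynomial identity. -/

/-- The coefficient of the triple sum attached to three sequences `β`, `φ`, `γ`, extended by zero
outside of the range `j ≤ k ≤ i + j`. -/
def tripleSeq (β φ γ : ℕ → ℂ) (i j k : ℕ) : ℂ :=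
  if j ≤ k ∧ k ≤ i + j then
    (-1) ^ j * (k.factorial : ℂ)
        / ((j.factorial : ℂ) * ((k - j).factorial : ℂ) * ((i + j - k).factorial : ℂ))
      * (∏ l ∈ Finset.Icc (j + 1) k, φ l)
      * ((∏ l ∈ Finset.Ico k (i + j), γ l) / ∏ l ∈ Finset.range i, β l)
  else 0

/-- `tripleSeq` in the coordinates `r = i + j - k`, `s = k - j`. -/
def tripleSeqAux (β φ γ : ℕ → ℂ) (r s j : ℕ) : ℂ :=
  (-1) ^ j * ((j + s).factorial : ℂ)
      / ((j.factorial : ℂ) * (s.factorial : ℂ) * (r.factorial : ℂ))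
    * (∏ l ∈ Finset.range s, φ (j + 1 + l))
    * ((∏ l ∈ Finset.range r, γ (j + s + l)) / ∏ l ∈ Finset.range (s + r), β l)

variable {β φ γ : ℕ → ℂ}

/-- In the coordinates r, s, j the support conditions and truncated subtractions disappear, and a
shift of one index changes each product by one factor. -/
lemma tripleSeq_eq_aux {i j k r s : ℕ} (hk : k = j + s) (hi : i = s + r) :
    tripleSeq β φ γ i j k = tripleSeqAux β φ γ r s j := by
  subst hk hi
  have h1 : Finset.Icc (j + 1) (j + s) = Finset.Ico (j + 1) (j + s + 1) := by
    ext l; simp only [Finset.mem_Icc, Finset.mem_Ico]; omega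
  rw [tripleSeq, tripleSeqAux, if_pos (by omega), h1, Finset.prod_Ico_eq_prod_range,
    Finset.prod_Ico_eq_prod_range, show j + s + 1 - (j + 1) = s by omega,
    show s + r + j - (j + s) = r by omega, show j + s - j = s by omega]

lemma tripleSeq_of_lt {i j k : ℕ} (h : k < j) : tripleSeq β φ γ i j k = 0 :=
  if_neg (by omega)

lemma tripleSeq_of_gt {i j k : ℕ} (h : i + j < k) : tripleSeq β φ γ i j k = 0 :=
  if_neg (by omega)

lemma tripleSeq_zero_left (j k : ℕ) :
    tripleSeq β φ γ 0 j k = if k = j then (-1) ^ j else 0 := by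
  split_ifs with h
  · subst h
    rw [tripleSeq_eq_aux (j := k) (r := 0) (s := 0) (by omega) (by omega)]
    have := Nat.factorial_ne_zero k
    simp [tripleSeqAux]
    field_simp
  · exact if_neg (by omega)

lemma cast_add_one_ne (r : ℕ) : (r : ℂ) + 1 ≠ 0 := Nat.cast_add_one_ne_zero r

lemma cast_factorial_ne (r : ℕ) : (r.factorial : ℂ) ≠ 0 := by
  exact_mod_cast Nat.factorial_ne_zero r

lemma aux_succ_left (hβ : ∀ n, β n ≠ 0) (r s j : ℕ) :
    ((r : ℂ) + 1) * β (s + r) * tripleSeqAux β φ γ (r + 1) s j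
      = γ (j + s + r) * tripleSeqAux β φ γ r s j := by
  have hB : ∏ l ∈ Finset.range (s + r), β l ≠ 0 := Finset.prod_ne_zero_iff.2 fun _ _ => hβ _
  have := hβ (s + r)
  have := cast_add_one_ne r
  have := cast_factorial_ne r
  have := cast_factorial_ne s
  have := cast_factorial_ne j
  rw [tripleSeqAux, tripleSeqAux, ← add_assoc s r 1, Finset.prod_range_succ _ r,
    Finset.prod_range_succ _ (s + r), Nat.factorial_succ r]
  push_cast
  field_simp

lemma aux_succ_right (r s j : ℕ) :
    ((r : ℂ) + 1) * ((j : ℂ) + 1) * φ (j + 1) * tripleSeqAux β φ γ (r + 1) s (j + 1)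
      = -(((s : ℂ) + 1) * γ (j + s + 1 + r) * tripleSeqAux β φ γ r (s + 1) j) := by
  have := cast_add_one_ne r
  have := cast_add_one_ne s
  have := cast_add_one_ne j
  have := cast_factorial_ne r
  have := cast_factorial_ne s
  have := cast_factorial_ne j
  have e1 : ∏ l ∈ Finset.range (s + 1), φ (j + 1 + l)
      = φ (j + 1) * ∏ l ∈ Finset.range s, φ (j + 1 + 1 + l) := by
    rw [Finset.prod_range_succ', mul_comm]
    congr 1
    exact Finset.prod_congr rfl fun l _ => by congr 1; ring
  have e2 : ∏ l ∈ Finset.range (r + 1), γ (j + 1 + s + l)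
      = (∏ l ∈ Finset.range r, γ (j + (s + 1) + l)) * γ (j + s + 1 + r) := by
    rw [Finset.prod_range_succ, show j + 1 + s = j + (s + 1) by ring, ← add_assoc]
  rw [tripleSeqAux, tripleSeqAux, e1, e2, show s + (r + 1) = s + 1 + r by ring,
    show j + 1 + s = j + (s + 1) by ring, Nat.factorial_succ r, Nat.factorial_succ s,
    Nat.factorial_succ j]
  push_cast
  field_simp
  ring

lemma aux_succ_mid (r s j : ℕ) :
    ((s : ℂ) + 1) * γ (j + s) * tripleSeqAux β φ γ r (s + 1) j
      = ((j : ℂ) + s + 1) * ((r : ℂ) + 1) * φ (j + s + 1) * tripleSeqAux β φ γ (r + 1) s j := by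
  have := cast_add_one_ne r
  have := cast_add_one_ne s
  have := cast_factorial_ne r
  have := cast_factorial_ne s
  have := cast_factorial_ne j
  have e2 : ∏ l ∈ Finset.range (r + 1), γ (j + s + l)
      = γ (j + s) * ∏ l ∈ Finset.range r, γ (j + (s + 1) + l) := by
    rw [Finset.prod_range_succ', mul_comm]
    congr 1
    exact Finset.prod_congr rfl fun l _ => by congr 1; ring
  rw [tripleSeqAux, tripleSeqAux, e2, Finset.prod_range_succ _ s,
    show s + (r + 1) = s + 1 + r by ring, ← add_assoc j s 1, show j + 1 + s = j + s + 1 by ring,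
    Nat.factorial_succ (j + s), Nat.factorial_succ r, Nat.factorial_succ s]
  push_cast
  field_simp

lemma tripleSeq_succ_left (hβ : ∀ n, β n ≠ 0) (i j k : ℕ) :
    γ (i + j) * tripleSeq β φ γ i j k
      = ((i : ℂ) + 1 + j - k) * β i * tripleSeq β φ γ (i + 1) j k := by
  rcases lt_or_ge k j with h | h
  · simp [tripleSeq_of_lt h]
  obtain ⟨s, rfl⟩ := Nat.exists_eq_add_of_le h
  rcases lt_or_ge i s with h' | h'
  · rw [tripleSeq_of_gt (i := i) (by omega)]
    rcases (Nat.succ_le_of_lt h').eq_or_lt with h'' | h''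
    · rw [← h'']; push_cast; ring
    · rw [tripleSeq_of_gt (by omega)]; ring
  obtain ⟨r, rfl⟩ := Nat.exists_eq_add_of_le h'
  rw [tripleSeq_eq_aux rfl rfl, tripleSeq_eq_aux (r := r + 1) rfl (by ring)]
  have := aux_succ_left (φ := φ) (γ := γ) hβ r s j
  rw [show s + r + j = j + s + r by ring, ← this]
  push_cast; ring

lemma tripleSeq_zero_left_mul (j k : ℕ) :
    ((j : ℂ) - k) * tripleSeq β φ γ 0 j k = 0 := by
  rw [tripleSeq_zero_left]
  split_ifs with h
  · rw [h]; ring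
  · ring

lemma tripleSeq_left_add_right (hβ : ∀ n, β n ≠ 0) (i j k : ℕ) :
    ((i : ℂ) + 1) * β i * tripleSeq β φ γ (i + 1) j k
        + ((j : ℂ) + 1) * φ (j + 1) * tripleSeq β φ γ i (j + 1) k
      = γ (i + j) * tripleSeq β φ γ i j k := by
  rcases lt_or_ge k j with h | h
  · simp [tripleSeq_of_lt h, tripleSeq_of_lt (Nat.lt_succ_of_lt h)]
  obtain ⟨s, rfl⟩ := Nat.exists_eq_add_of_le h
  rcases lt_or_ge i s with h' | h'
  · rw [tripleSeq_of_gt (i := i) (j := j) (by omega)]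
    -- On the edge k = i + j + 1 the right-hand side is zero, but both terms on the left survive and
    -- must cancel.
    rcases (Nat.succ_le_of_lt h').eq_or_lt with h'' | h''
    · subst h''
      rw [tripleSeq_eq_aux (s := i + 1) (r := 0) rfl rfl,
        tripleSeq_eq_aux (s := i) (r := 0) (by omega) (by omega)]
      have e1 : ∏ l ∈ Finset.range (i + 1), φ (j + 1 + l)
          = φ (j + 1) * ∏ l ∈ Finset.range i, φ (j + 1 + 1 + l) := by
        rw [Finset.prod_range_succ', mul_comm]
        congr 1
        exact Finset.prod_congr rfl fun l _ => by congr 1; ring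
      have hB : ∏ l ∈ Finset.range i, β l ≠ 0 := Finset.prod_ne_zero_iff.2 fun _ _ => hβ _
      have := hβ i
      have := cast_add_one_ne i
      have := cast_add_one_ne j
      have := cast_factorial_ne i
      have := cast_factorial_ne j
      rw [tripleSeqAux, tripleSeqAux, e1, add_zero, add_zero, Finset.prod_range_succ,
        show j + 1 + i = j + (i + 1) by ring, Nat.factorial_succ i, Nat.factorial_succ j]
      push_cast
      field_simp
      ring
    · rw [tripleSeq_of_gt (by omega), tripleSeq_of_gt (by omega)]; ring
  obtain ⟨r, rfl⟩ := Nat.exists_eq_add_of_le h'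
  rw [tripleSeq_eq_aux (i := s + r) (j := j) rfl rfl,
    tripleSeq_eq_aux (r := r + 1) rfl (by ring)]
  have h1 := aux_succ_left (φ := φ) (γ := γ) hβ r s j
  rw [show s + r + j = j + s + r by ring]
  rcases s with _ | s
  · rw [tripleSeq_of_lt (by omega)]
    rw [← h1]; push_cast; ring
  · rw [tripleSeq_eq_aux (s := s) (r := r + 1) (by ring) (by ring)]
    have h2 := aux_succ_right (β := β) (φ := φ) (γ := γ) r s j
    rw [show j + s + 1 + r = j + (s + 1) + r by ring] at h2
    apply mul_left_cancel₀ (cast_add_one_ne r)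
    push_cast at h1 ⊢
    linear_combination h2 + ((r : ℂ) + s + 2) * h1

/-- Each term on the left is a rational multiple of `tripleSeq β φ γ i (j + 1) k`, with denominator
k - j + 1. Their sum has (k+1) φ(k+1) - (j+1) φ(j+1) in the numerator, so the denominator cancels
against a divided difference. -/
lemma tripleSeq_diag {ψ : ℕ → ℕ → ℂ} (hβ : ∀ n, β n ≠ 0)
    (hψ : ∀ x y : ℕ, (x : ℂ) * φ x - y * φ y = ((x : ℂ) - y) * ψ x y) (i j k : ℕ) :
    γ (i + j) * tripleSeq β φ γ i j k + γ k * tripleSeq β φ γ i (j + 1) (k + 1)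
      = ((i : ℂ) + (j + 1) - k) * ψ (j + 1) (k + 1) * tripleSeq β φ γ i (j + 1) k := by
  rcases lt_or_ge k j with h | h
  · simp [tripleSeq_of_lt h, tripleSeq_of_lt (Nat.lt_succ_of_lt h),
      tripleSeq_of_lt (Nat.succ_lt_succ h)]
  obtain ⟨s, rfl⟩ := Nat.exists_eq_add_of_le h
  rcases s with _ | s
  · rw [tripleSeq_of_lt (j := j + 1) (k := j + 0) (by omega),
      tripleSeq_eq_aux (j := j) (k := j + 0) (s := 0) (r := i) rfl (by omega),
      tripleSeq_eq_aux (j := j + 1) (k := j + 0 + 1) (s := 0) (r := i) (by omega) (by omega)]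
    have e2 : (∏ l ∈ Finset.range i, γ (j + l)) * γ (i + j)
        = γ j * ∏ l ∈ Finset.range i, γ (j + 1 + l) := by
      rw [add_comm i j, ← Finset.prod_range_succ (fun l => γ (j + l)), Finset.prod_range_succ',
        mul_comm]
      congr 1
      exact Finset.prod_congr rfl fun l _ => by congr 1; ring
    have hB : ∏ l ∈ Finset.range i, β l ≠ 0 := Finset.prod_ne_zero_iff.2 fun _ _ => hβ _
    have := cast_factorial_ne i
    have := cast_factorial_ne j
    have := cast_factorial_ne (j + 1)
    simp only [tripleSeqAux, add_zero, zero_add, Finset.range_zero, Finset.prod_empty]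
    field_simp
    linear_combination (-1) ^ j * e2
  rcases lt_or_ge i s with h' | h'
  · rw [tripleSeq_of_gt (by omega), tripleSeq_of_gt (by omega), tripleSeq_of_gt (by omega)]; ring
  obtain ⟨r, rfl⟩ := Nat.exists_eq_add_of_le h'
  rw [tripleSeq_eq_aux (j := j + 1) (k := j + (s + 1)) (s := s) (r := r) (by ring) rfl]
  rcases r with _ | r
  · rw [tripleSeq_of_gt (by omega), tripleSeq_of_gt (by omega)]
    push_cast; ring
  rw [tripleSeq_eq_aux (s := s + 1) (r := r) rfl (by ring),
    tripleSeq_eq_aux (s := s + 1) (r := r) (by ring) (by ring)]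
  have h2 := aux_succ_right (β := β) (φ := φ) (γ := γ) r s j
  have h3 := aux_succ_mid (β := β) (φ := φ) (γ := γ) r s (j + 1)
  have h4 := hψ (j + 1) (j + (s + 1) + 1)
  rw [show s + (r + 1) + j = j + s + 1 + r by ring]
  rw [show j + 1 + s = j + (s + 1) by ring] at h3
  apply mul_left_cancel₀ (cast_add_one_ne s)
  push_cast at h2 h3 h4 ⊢
  linear_combination h3 + h2 - ((r : ℂ) + 1) * tripleSeqAux β φ γ (r + 1) s (j + 1) * h4

lemma tripleSeq_diag_zero (i k : ℕ) :
    γ k * tripleSeq β φ γ i 0 (k + 1)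
      = ((i : ℂ) - k) * φ (k + 1) * tripleSeq β φ γ i 0 k := by
  rcases lt_or_ge i k with h | h
  · rw [tripleSeq_of_gt (by omega), tripleSeq_of_gt (by omega)]; ring
  obtain ⟨r, rfl⟩ := Nat.exists_eq_add_of_le h
  rw [tripleSeq_eq_aux (i := k + r) (k := k) (s := k) (r := r) (by ring) rfl]
  rcases r with _ | r
  · rw [tripleSeq_of_gt (by omega)]
    push_cast; ring
  rw [tripleSeq_eq_aux (s := k + 1) (r := r) (by ring) (by ring)]
  have h3 := aux_succ_mid (β := β) (φ := φ) (γ := γ) r k 0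
  rw [zero_add] at h3
  apply mul_left_cancel₀ (cast_add_one_ne k)
  push_cast at h3 ⊢
  linear_combination h3

/-- The mechanism of `tripleSeq_diag` with γ in place of x φ(x): the denominator i + j - k cancels
against γ(i+j) - γ(k). On the edge k = i + j the two left terms cancel by themselves. -/
lemma tripleSeq_right_add_mid {χ : ℕ → ℕ → ℂ} (hβ : ∀ n, β n ≠ 0)
    (hχ : ∀ x y : ℕ, γ x - γ y = ((x : ℂ) - y) * χ x y) (i j k : ℕ) :
    ((j : ℂ) + 1) * φ (j + 1) * tripleSeq β φ γ i (j + 1) (k + 1)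
        + ((k : ℂ) + 1) * φ (k + 1) * tripleSeq β φ γ i j k
      = -(((k : ℂ) + 1 - j) * χ (i + j) k * tripleSeq β φ γ i j (k + 1)) := by
  rcases lt_or_ge k j with h | h
  · rw [tripleSeq_of_lt h, tripleSeq_of_lt (Nat.succ_lt_succ h)]
    rcases (Nat.succ_le_of_lt h).eq_or_lt with h'' | h''
    · rw [← h'']; push_cast; ring
    · rw [tripleSeq_of_lt h'']; ring
  obtain ⟨s, rfl⟩ := Nat.exists_eq_add_of_le h
  rcases lt_or_ge i s with h' | h'
  · rw [tripleSeq_of_gt (by omega), tripleSeq_of_gt (by omega), tripleSeq_of_gt (by omega)]; ring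
  obtain ⟨r, rfl⟩ := Nat.exists_eq_add_of_le h'
  rw [tripleSeq_eq_aux (j := j) (k := j + s) (s := s) (r := r) (by ring) rfl,
    tripleSeq_eq_aux (j := j + 1) (s := s) (r := r) (by ring) rfl]
  rcases r with _ | r
  · rw [tripleSeq_of_gt (by omega)]
    have e1 : φ (j + 1) * ∏ l ∈ Finset.range s, φ (j + 1 + 1 + l)
        = (∏ l ∈ Finset.range s, φ (j + 1 + l)) * φ (j + s + 1) := by
      rw [show j + s + 1 = j + 1 + s by ring, ← Finset.prod_range_succ (fun l => φ (j + 1 + l)),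
        Finset.prod_range_succ', mul_comm]
      congr 1
      exact Finset.prod_congr rfl fun l _ => by congr 1; ring
    have hB : ∏ l ∈ Finset.range s, β l ≠ 0 := Finset.prod_ne_zero_iff.2 fun _ _ => hβ _
    have := cast_add_one_ne j
    have := cast_factorial_ne s
    have := cast_factorial_ne j
    simp only [tripleSeqAux, add_zero, Finset.range_zero, Finset.prod_empty,
      show j + 1 + s = j + s + 1 by ring, Nat.factorial_succ j, Nat.factorial_succ (j + s)]
    push_cast
    field_simp
    linear_combination -(-1) ^ j * ((j : ℂ) + s + 1) * ((j + s).factorial : ℂ) * e1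
  rw [tripleSeq_eq_aux (s := s + 1) (r := r) (by ring) (by ring)]
  have h2 := aux_succ_right (β := β) (φ := φ) (γ := γ) r s j
  have h3 := aux_succ_mid (β := β) (φ := φ) (γ := γ) r s j
  have h4 := hχ (s + (r + 1) + j) (j + s)
  rw [show j + s + 1 + r = s + (r + 1) + j by ring] at h2
  apply mul_left_cancel₀ (cast_add_one_ne r)
  push_cast at h2 h3 h4 ⊢
  linear_combination h2 - h3 - ((s : ℂ) + 1) * tripleSeqAux β φ γ r (s + 1) j * h4

end Coefficients


/-! ### Symbols of the operator at the points 0, 1 and ∞. -/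

section Symbols

/-- The operator `D` sends `x ^ n` to
`n * symbolDown (n - 1) * x ^ (n - 1) + symbolMid n * x ^ n + symbolUp n * x ^ (n + 1)`. -/
def symbolDown (a₁ a₃ x : ℂ) : ℂ := x ^ 2 - (a₁ + 1) * x + a₃

/-- The diagonal coefficient of `D` in the basis of powers of `x`. -/
def symbolMid (a₁ a₂ a₄ x : ℂ) : ℂ :=
  -2 * (x * (x - 1) * (x - 2)) + (a₁ - a₂) * (x * (x - 1)) + a₄ * x

/-- The degree-raising coefficient of `D` in the basis of powers of `x`. -/
def symbolUp (a₂ a₅ a₆ x : ℂ) : ℂ := x ^ 3 + (a₂ - 3) * x ^ 2 + (a₅ - a₂ + 2) * x + a₆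

/-- The degree-lowering coefficient of `D` in the basis of powers of `x - 1`, divided by the
exponent. -/
def symbolOne (a₁ a₂ a₃ a₄ a₅ x : ℂ) : ℂ :=
  a₃ + a₄ + a₅ + (x - 1) * (a₁ + a₂) + (x - 1) * (x - 2)

/-- The diagonal coefficient of `D` in the basis of powers of `x - 1`. -/
def symbolOneMid (a₁ a₂ a₄ a₅ a₆ x : ℂ) : ℂ :=
  2 * (x * (x - 1) * (x - 2)) + (a₁ + 2 * a₂) * (x * (x - 1)) + (a₄ + 2 * a₅) * x + a₆

/-- The divided difference of `symbolUp`. -/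
def symbolUpDiff (a₂ a₅ x y : ℂ) : ℂ :=
  x ^ 2 + x * y + y ^ 2 + (a₂ - 3) * (x + y) + (a₅ - a₂ + 2)

/-- The divided difference of `x * symbolOne x`. -/
def symbolOneDiff (a₁ a₂ a₃ a₄ a₅ x y : ℂ) : ℂ :=
  x ^ 2 + x * y + y ^ 2 + (a₁ + a₂ - 3) * (x + y) + (a₃ + a₄ + a₅ - a₁ - a₂ + 2)

/-- The diagonal coefficient of `D` on the products `x ^ i * (x - 1) ^ j`. -/
def symbolCross (a₁ a₂ a₄ a₅ a₆ x y : ℂ) : ℂ :=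
  symbolOneMid a₁ a₂ a₄ a₅ a₆ (x + y) - symbolUp a₂ a₅ a₆ (x + y)
    - x * symbolUpDiff a₂ a₅ (x + y) (x + y - 1)

end Symbols

/-! ### The operator on formal power series. -/

section FormalOperator

open scoped PowerSeries

local notation "𝕏" => (PowerSeries.X : PowerSeries ℂ)

/-- The operator `D` on formal power series. -/
def formalOp (a₁ a₂ a₃ a₄ a₅ a₆ lam : ℂ) (F : ℂ⟦X⟧) : ℂ⟦X⟧ :=
  𝕏 ^ 2 * (𝕏 - 1) ^ 2 * d⁄dX ℂ (d⁄dX ℂ (d⁄dX ℂ F))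
    + 𝕏 * (𝕏 - 1) * (PowerSeries.C a₁ + PowerSeries.C a₂ * 𝕏) * d⁄dX ℂ (d⁄dX ℂ F)
    + (PowerSeries.C a₃ + PowerSeries.C a₄ * 𝕏 + PowerSeries.C a₅ * 𝕏 ^ 2) * d⁄dX ℂ F
    + (PowerSeries.C a₆ * 𝕏 + PowerSeries.C lam) * F

/-- The sequence `n ↦ n * β (n - 1) * c (n - 1)`. -/
def lower (β c : ℕ → ℂ) : ℕ → ℂ
  | 0 => 0
  | n + 1 => ((n : ℂ) + 1) * β n * c n

/-- The sequence `n ↦ γ (n - 1) * c (n - 1)`. -/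
def raise (γ c : ℕ → ℂ) : ℕ → ℂ
  | 0 => 0
  | n + 1 => γ n * c n

/-- The three-term operator on coefficient sequences. -/
def seqOp (β q γ c : ℕ → ℂ) (n : ℕ) : ℂ :=
  ((n : ℂ) + 1) * β n * c (n + 1) + q n * c n + raise γ c n

/-- The transpose of `seqOp`. -/
def seqOpAdj (β q γ c : ℕ → ℂ) (n : ℕ) : ℂ :=
  lower β c n + q n * c n + γ n * c (n + 1)

lemma coeff_formalOp (a₁ a₂ a₃ a₄ a₅ a₆ lam : ℂ) (F : ℂ⟦X⟧) (n : ℕ) :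
    PowerSeries.coeff n (formalOp a₁ a₂ a₃ a₄ a₅ a₆ lam F)
      = seqOp (fun n => symbolDown a₁ a₃ n) (fun n => symbolMid a₁ a₂ a₄ n)
          (fun n => symbolUp a₂ a₅ a₆ n) (fun n => PowerSeries.coeff n F) n + lam * PowerSeries.coeff n F := by
  have h : formalOp a₁ a₂ a₃ a₄ a₅ a₆ lam F
      = 𝕏 ^ 4 * d⁄dX ℂ (d⁄dX ℂ (d⁄dX ℂ F)) - PowerSeries.C 2 * (𝕏 ^ 3 * d⁄dX ℂ (d⁄dX ℂ (d⁄dX ℂ F)))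
        + 𝕏 ^ 2 * d⁄dX ℂ (d⁄dX ℂ (d⁄dX ℂ F))
        + PowerSeries.C a₂ * (𝕏 ^ 3 * d⁄dX ℂ (d⁄dX ℂ F)) + PowerSeries.C a₁ * (𝕏 ^ 2 * d⁄dX ℂ (d⁄dX ℂ F))
        - PowerSeries.C a₂ * (𝕏 ^ 2 * d⁄dX ℂ (d⁄dX ℂ F))
        - PowerSeries.C a₁ * (𝕏 ^ 1 * d⁄dX ℂ (d⁄dX ℂ F))
        + PowerSeries.C a₃ * d⁄dX ℂ F + PowerSeries.C a₄ * (𝕏 ^ 1 * d⁄dX ℂ F) + PowerSeries.C a₅ * (𝕏 ^ 2 * d⁄dX ℂ F)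
        + PowerSeries.C a₆ * (𝕏 ^ 1 * F) + PowerSeries.C lam * F := by
    simp only [formalOp, map_ofNat]
    ring
  rw [h]
  simp only [map_add, map_sub, PowerSeries.coeff_C_mul, PowerSeries.coeff_X_pow_mul', seqOp]
  -- The powers of `𝕏` go up to 4, so these five cases decide every condition in
  -- `PowerSeries.coeff_X_pow_mul'`.
  rcases n with _ | _ | _ | _ | n <;>
  · simp [PowerSeries.coeff_derivative, raise, symbolDown, symbolMid, symbolUp]
    try ring

/-- The logarithmic derivative of F = x^i (x-1)^j gives x(x-1) F' = (i(x-1) + jx) F; differentiating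
twice expresses the higher derivatives as well. The diagonal coefficient can be predicted from the
coefficient of (x-1)^(i+j): with n = i + j it is q'(n) + i γ(n-1) - (i+1) γ(n), which is
`symbolCross`. -/
lemma formalOp_X_pow_mul (a₁ a₂ a₃ a₄ a₅ a₆ : ℂ) (i j : ℕ) :
    formalOp a₁ a₂ a₃ a₄ a₅ a₆ 0 (𝕏 ^ i * (𝕏 - 1) ^ j)
      = PowerSeries.C (i * symbolDown a₁ a₃ (i - 1)) * (𝕏 ^ (i - 1) * (𝕏 - 1) ^ j)
        + PowerSeries.C (j * symbolOne a₁ a₂ a₃ a₄ a₅ j) * (𝕏 ^ i * (𝕏 - 1) ^ (j - 1))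
        + PowerSeries.C (symbolUp a₂ a₅ a₆ (i + j)) * (𝕏 ^ (i + 1) * (𝕏 - 1) ^ j)
        + PowerSeries.C (symbolCross a₁ a₂ a₄ a₅ a₆ i j) * (𝕏 ^ i * (𝕏 - 1) ^ j) := by
  have hX1 : (𝕏 - 1 : ℂ⟦X⟧) ≠ 0 := by
    intro h
    simpa using congrArg (PowerSeries.coeff (R := ℂ) 0) h
  -- The exponent i - 1 is truncated at i = 0, where the factor i makes the identity true.
  have hi : (i : ℂ⟦X⟧) * (𝕏 ^ (i - 1) * 𝕏) = i * 𝕏 ^ i := by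
    rcases i with _ | i
    · simp
    · rw [Nat.add_sub_cancel, pow_succ]
  have hj : (j : ℂ⟦X⟧) * ((𝕏 - 1) ^ (j - 1) * (𝕏 - 1)) = j * (𝕏 - 1) ^ j := by
    rcases j with _ | j
    · simp
    · rw [Nat.add_sub_cancel, pow_succ]
  set F : ℂ⟦X⟧ := 𝕏 ^ i * (𝕏 - 1) ^ j with hF
  have hd : d⁄dX ℂ F = (i * 𝕏 ^ (i - 1)) * (𝕏 - 1) ^ j + 𝕏 ^ i * (j * (𝕏 - 1) ^ (j - 1)) := by
    rw [hF, Derivation.leibniz, PowerSeries.derivative_pow, PowerSeries.derivative_pow, map_sub, PowerSeries.derivative_X,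
      PowerSeries.derivative_one]
    simp only [smul_eq_mul]
    ring
  have h1 : 𝕏 * (𝕏 - 1) * d⁄dX ℂ F = (i * (𝕏 - 1) + j * 𝕏) * F := by
    rw [hd, hF]
    linear_combination (𝕏 - 1) * (𝕏 - 1) ^ j * hi + 𝕏 * 𝕏 ^ i * hj
  have h2 : (2 * 𝕏 - 1) * d⁄dX ℂ F + 𝕏 * (𝕏 - 1) * d⁄dX ℂ (d⁄dX ℂ F)
      = (i + j) * F + (i * (𝕏 - 1) + j * 𝕏) * d⁄dX ℂ F := by
    have := congrArg (d⁄dX ℂ) h1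
    simp only [Derivation.leibniz, smul_eq_mul, map_add, map_sub, PowerSeries.derivative_X, PowerSeries.derivative_one,
      Derivation.map_natCast] at this
    linear_combination this
  have h3 : 2 * d⁄dX ℂ F + 2 * (2 * 𝕏 - 1) * d⁄dX ℂ (d⁄dX ℂ F)
        + 𝕏 * (𝕏 - 1) * d⁄dX ℂ (d⁄dX ℂ (d⁄dX ℂ F))
      = 2 * (i + j) * d⁄dX ℂ F + (i * (𝕏 - 1) + j * 𝕏) * d⁄dX ℂ (d⁄dX ℂ F) := by
    have := congrArg (d⁄dX ℂ) h2
    have h20 : d⁄dX ℂ (2 : ℂ⟦X⟧) = 0 := by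
      simpa using Derivation.map_natCast (d⁄dX ℂ) 2
    simp only [Derivation.leibniz, smul_eq_mul, map_add, map_sub, PowerSeries.derivative_X, PowerSeries.derivative_one,
      Derivation.map_natCast, h20] at this
    linear_combination this
  apply mul_left_cancel₀ (mul_ne_zero PowerSeries.X_ne_zero hX1)
  simp only [formalOp, symbolDown, symbolOne, symbolUp, symbolCross, symbolOneMid, symbolUpDiff,
    map_add, map_sub, map_mul, map_pow, map_one, map_ofNat, map_natCast, map_zero]
  set F1 := d⁄dX ℂ F
  set F2 := d⁄dX ℂ F1
  set F3 := d⁄dX ℂ F2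
  rw [pow_succ 𝕏 i]
  -- The coefficients come from eliminating F''', then F'', then F', in the goal multiplied by
  -- x(x-1).
  linear_combination (𝕏 * (𝕏 - 1)) ^ 2 * h3
    + 𝕏 * (𝕏 - 1) * ((i * (𝕏 - 1) + j * 𝕏 : ℂ⟦X⟧) - 2 * (2 * 𝕏 - 1) + (PowerSeries.C a₁ + PowerSeries.C a₂ * 𝕏)) * h2
    + (𝕏 * (𝕏 - 1) * (2 * (i + j) - 2) + (PowerSeries.C a₃ + PowerSeries.C a₄ * 𝕏 + PowerSeries.C a₅ * 𝕏 ^ 2)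
      + ((i * (𝕏 - 1) + j * 𝕏 : ℂ⟦X⟧) - 2 * (2 * 𝕏 - 1) + (PowerSeries.C a₁ + PowerSeries.C a₂ * 𝕏))
        * ((i * (𝕏 - 1) + j * 𝕏 : ℂ⟦X⟧) - (2 * 𝕏 - 1))) * h1
    - (𝕏 - 1) * (𝕏 - 1) ^ j * ((i - 1) ^ 2 - (PowerSeries.C a₁ + 1) * (i - 1) + PowerSeries.C a₃) * hi
    - 𝕏 * 𝕏 ^ i * (PowerSeries.C a₃ + PowerSeries.C a₄ + PowerSeries.C a₅ + (j - 1) * (PowerSeries.C a₁ + PowerSeries.C a₂) + (j - 1) * (j - 2)) * hj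

end FormalOperator


/-! ### Coefficients of the products of powers of x and x - 1, and the sums built from them. -/

/-- The coefficient of `X ^ p` in `X ^ i * (X - 1) ^ j`. -/
def xCoeff (i j p : ℕ) : ℂ := (X ^ i * (X - 1) ^ j : ℂ[X]).coeff p

lemma xCoeff_of_lt {i j p : ℕ} (h : p < i) : xCoeff i j p = 0 := by
  rw [xCoeff, coeff_X_pow_mul', if_neg (by omega)]

lemma xCoeff_succ_right (i j p : ℕ) :
    xCoeff i (j + 1) p = xCoeff (i + 1) j p - xCoeff i j p := by
  rw [xCoeff, xCoeff, xCoeff, ← coeff_sub]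
  congr 1
  ring

lemma coeff_X_pow_mul_eq_xCoeff (i j p : ℕ) :
    PowerSeries.coeff p (PowerSeries.X ^ i * (PowerSeries.X - 1) ^ j : PowerSeries ℂ)
      = xCoeff i j p := by
  rw [xCoeff, ← Polynomial.coeff_coe]
  simp

lemma seqOp_xCoeff (a₁ a₂ a₃ a₄ a₅ a₆ : ℂ) (i j p : ℕ) :
    seqOp (fun n => symbolDown a₁ a₃ n) (fun n => symbolMid a₁ a₂ a₄ n)
        (fun n => symbolUp a₂ a₅ a₆ n) (xCoeff i j) p
      = lower (fun n => symbolDown a₁ a₃ n) (fun i' => xCoeff i' j p) i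
        + lower (fun n => symbolOne a₁ a₂ a₃ a₄ a₅ (n + 1 : ℕ)) (fun j' => xCoeff i j' p) j
        + symbolUp a₂ a₅ a₆ (i + j : ℕ) * xCoeff (i + 1) j p
        + symbolCross a₁ a₂ a₄ a₅ a₆ i j * xCoeff i j p := by
  have h := congrArg (PowerSeries.coeff p) (formalOp_X_pow_mul a₁ a₂ a₃ a₄ a₅ a₆ i j)
  simp only [coeff_formalOp, map_add, PowerSeries.coeff_C_mul, coeff_X_pow_mul_eq_xCoeff,
    zero_mul, add_zero] at h
  change seqOp _ _ _ (xCoeff i j) p = _ at h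
  rw [h]
  push_cast
  congr 3
  · rcases i with _ | i
    · simp [lower]
    · simp [lower]
  · rcases j with _ | j
    · simp [lower]
    · simp [lower]

/-- Summation by parts in the form used throughout: a lowering or raising term is reindexed, and the
boundary term vanishes. -/
lemma sum_range_shift {f g : ℕ → ℂ} {N : ℕ} (h0 : f 0 = 0) (h : ∀ i, f (i + 1) = g i)
    (hN : g N = 0) : ∑ i ∈ Finset.range (N + 1), f i = ∑ i ∈ Finset.range (N + 1), g i := by
  rw [Finset.sum_range_succ', Finset.sum_range_succ, h0, hN]
  simp [h]

/-- The coefficient of `x₁ ^ p * x₂ ^ q` in `∑ t i j k * (x₁ x₂) ^ i * ((x₁ - 1) (x₂ - 1)) ^ j`,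
summed over `i < N` and `j < J`. -/
def truncSum (t : ℕ → ℕ → ℕ → ℂ) (N J p q k : ℕ) : ℂ :=
  ∑ i ∈ Finset.range N, ∑ j ∈ Finset.range J, t i j k * (xCoeff i j p * xCoeff i j q)

/-- The coefficient of `x₁ ^ p * x₂ ^ q` in `∑ t i j k * (x₁ x₂) ^ i * ((x₁ - 1) (x₂ - 1)) ^ j`,
provided that `t i j k = 0` for `k < j`. -/
def fullSum (t : ℕ → ℕ → ℕ → ℂ) (p q k : ℕ) : ℂ := truncSum t (p + 1) (k + 1) p q k

/-- The binomial transform of `fullSum`. -/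
def binomSum (t : ℕ → ℕ → ℕ → ℂ) (p q n : ℕ) : ℂ :=
  ∑ k ∈ Finset.range (n + 1), (n.choose k : ℂ) * fullSum t p q k

/-! ### The bispectral equation for the triple sum, and its uniqueness. -/

section Recurrence

variable {t : ℕ → ℕ → ℕ → ℂ} {β q γ φ q' : ℕ → ℂ} {E : ℕ → ℕ → ℂ}

lemma fullSum_eq_truncSum (ht : ∀ i j k, k < j → t i j k = 0) {N J p s k : ℕ} (hN : p < N)
    (hJ : k < J) : fullSum t p s k = truncSum t N J p s k := by
  rw [fullSum, truncSum, truncSum]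
  rw [Finset.sum_subset (Finset.range_mono (Nat.succ_le_of_lt hN)) fun i _ hi => ?_]
  · refine Finset.sum_congr rfl fun i _ => ?_
    refine Finset.sum_subset (Finset.range_mono (Nat.succ_le_of_lt hJ)) fun j _ hj => ?_
    rw [ht i j k (by simpa using hj), zero_mul]
  · refine Finset.sum_eq_zero fun j _ => ?_
    rw [xCoeff_of_lt (p := p) (by simpa using hi)]
    ring

lemma seqOp_sum {ι : Type*} (s : Finset ι) (w : ι → ℂ) (c : ι → ℕ → ℂ) (n : ℕ) :
    seqOp β q γ (fun n => ∑ x ∈ s, w x * c x n) n = ∑ x ∈ s, w x * seqOp β q γ (c x) n := by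
  rcases n with _ | n <;>
  · simp only [seqOp, raise, Finset.mul_sum, add_zero, ← Finset.sum_add_distrib]
    exact Finset.sum_congr rfl fun _ _ => by ring

lemma seqOpAdj_sum {ι : Type*} (s : Finset ι) (w : ι → ℂ) (c : ι → ℕ → ℂ) (n : ℕ) :
    seqOpAdj β q γ (fun n => ∑ x ∈ s, w x * c x n) n
      = ∑ x ∈ s, w x * seqOpAdj β q γ (c x) n := by
  rcases n with _ | n <;>
  · simp only [seqOpAdj, lower, Finset.mul_sum, zero_add, ← Finset.sum_add_distrib]
    exact Finset.sum_congr rfl fun _ _ => by ring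

lemma seqOp_congr {c c' : ℕ → ℂ} {n : ℕ} (h : ∀ m ≤ n + 1, c m = c' m) :
    seqOp β q γ c n = seqOp β q γ c' n := by
  rcases n with _ | n
  · simp [seqOp, raise, h]
  · simp only [seqOp, raise]
    rw [h _ le_rfl, h _ (Nat.le_succ _), h n (by omega)]

lemma seqOpAdj_congr {c c' : ℕ → ℂ} {n : ℕ} (h : ∀ m ≤ n + 1, c m = c' m) :
    seqOpAdj β q γ c n = seqOpAdj β q γ c' n := by
  rcases n with _ | n
  · simp [seqOpAdj, lower, h]
  · simp only [seqOpAdj, lower]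
    rw [h _ le_rfl, h _ (Nat.le_succ _), h n (by omega)]

/-- After reindexing, `h₁` makes the coefficient of x₂ u^i v^j equal to that of x₁ u^i v^j, namely
γ(i+j) t_{ijk}, where u = x₁x₂ and v = (x₁-1)(x₂-1). Replacing x₁ + x₂ by u - v + 1 leaves exactly
the left side of `h₂` as coefficient of u^i v^j. -/
lemma seqOp_fullSum
    (ht : ∀ i j k, k < j → t i j k = 0)
    (hx : ∀ i j p, seqOp β q γ (xCoeff i j) p
      = lower β (fun i' => xCoeff i' j p) i + lower φ (fun j' => xCoeff i j' p) j
        + γ (i + j) * xCoeff (i + 1) j p + E i j * xCoeff i j p)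
    (h₁ : ∀ i j k : ℕ, ((i : ℂ) + 1) * β i * t (i + 1) j k + ((j : ℂ) + 1) * φ j * t i (j + 1) k
      = γ (i + j) * t i j k)
    (h₂ : ∀ i j k : ℕ, -(((j : ℂ) + 1) * φ j * t i (j + 1) k)
        + raise (fun i' => γ (i' + j)) (fun i' => t i' j k) i
        - raise (fun j' => γ (i + j')) (fun j' => t i j' k) j
        + γ (i + j) * t i j k + E i j * t i j k = seqOpAdj φ q' γ (t i j) k)
    (p s k : ℕ) :
    seqOp β q γ (fun p => fullSum t p s k) p = seqOpAdj φ q' γ (fullSum t p s) k := by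
  have hL : seqOp β q γ (fun p => fullSum t p s k) p
      = ∑ i ∈ Finset.range (p + 3), ∑ j ∈ Finset.range (k + 3),
          t i j k * xCoeff i j s * seqOp β q γ (xCoeff i j) p := by
    -- A common box that also covers the neighbours p + 1 and k + 1; on its boundary all shifted
    -- terms vanish.
    rw [seqOp_congr (c' := fun p' => truncSum t (p + 3) (k + 3) p' s k) fun m hm =>
      fullSum_eq_truncSum ht (by omega) (by omega)]
    simp only [truncSum]
    simp only [Finset.sum_sigma']
    rw [← seqOp_sum]
    congr 1
    funext p'
    exact Finset.sum_congr rfl fun _ _ => by ring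
  have hR : seqOpAdj φ q' γ (fullSum t p s) k
      = ∑ i ∈ Finset.range (p + 3), ∑ j ∈ Finset.range (k + 3),
          xCoeff i j p * xCoeff i j s * seqOpAdj φ q' γ (t i j) k := by
    rw [seqOpAdj_congr (c' := truncSum t (p + 3) (k + 3) p s) fun m hm =>
      fullSum_eq_truncSum ht (by omega) (by omega)]
    simp only [Finset.sum_sigma']
    rw [← seqOpAdj_sum]
    congr 1
    funext k'
    simp only [truncSum, Finset.sum_sigma']
    exact Finset.sum_congr rfl fun _ _ => by ring
  have hI1 : ∑ i ∈ Finset.range (p + 3), ∑ j ∈ Finset.range (k + 3),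
        t i j k * xCoeff i j s * lower β (fun i' => xCoeff i' j p) i
      = ∑ i ∈ Finset.range (p + 3), ∑ j ∈ Finset.range (k + 3),
        ((i : ℂ) + 1) * β i * t (i + 1) j k * (xCoeff i j p * xCoeff (i + 1) j s) := by
    apply sum_range_shift
    · simp [lower]
    · intro i
      exact Finset.sum_congr rfl fun j _ => by simp only [lower]; ring
    · refine Finset.sum_eq_zero fun j _ => ?_
      rw [xCoeff_of_lt (p := p) (by omega)]; ring
  have hI2 : ∑ i ∈ Finset.range (p + 3), ∑ j ∈ Finset.range (k + 3),
        t i j k * xCoeff i j s * lower φ (fun j' => xCoeff i j' p) j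
      = ∑ i ∈ Finset.range (p + 3), ∑ j ∈ Finset.range (k + 3),
        ((j : ℂ) + 1) * φ j * t i (j + 1) k
          * (xCoeff i j p * xCoeff (i + 1) j s - xCoeff i j p * xCoeff i j s) := by
    refine Finset.sum_congr rfl fun i _ => ?_
    apply sum_range_shift
    · simp [lower]
    · intro j
      simp only [lower, xCoeff_succ_right i j s]; ring
    · rw [ht _ _ _ (by omega)]; ring
  have hI3 : ∑ i ∈ Finset.range (p + 3), ∑ j ∈ Finset.range (k + 3),
        raise (fun i' => γ (i' + j)) (fun i' => t i' j k) i * (xCoeff i j p * xCoeff i j s)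
      = ∑ i ∈ Finset.range (p + 3), ∑ j ∈ Finset.range (k + 3),
        γ (i + j) * t i j k * (xCoeff (i + 1) j p * xCoeff (i + 1) j s) := by
    apply sum_range_shift
    · simp [raise]
    · intro i
      exact Finset.sum_congr rfl fun j _ => by simp only [raise]
    · refine Finset.sum_eq_zero fun j _ => ?_
      rw [xCoeff_of_lt (p := p) (by omega)]; ring
  have hI4 : ∑ i ∈ Finset.range (p + 3), ∑ j ∈ Finset.range (k + 3),
        raise (fun j' => γ (i + j')) (fun j' => t i j' k) j * (xCoeff i j p * xCoeff i j s)
      = ∑ i ∈ Finset.range (p + 3), ∑ j ∈ Finset.range (k + 3),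
        γ (i + j) * t i j k * (xCoeff i (j + 1) p * xCoeff i (j + 1) s) := by
    refine Finset.sum_congr rfl fun i _ => ?_
    apply sum_range_shift
    · simp [raise]
    · intro j
      simp only [raise]
    · rw [ht _ _ _ (by omega)]; ring
  rw [hL, hR, ← sub_eq_zero]
  have key : ∀ i j : ℕ,
      t i j k * xCoeff i j s * seqOp β q γ (xCoeff i j) p
        - xCoeff i j p * xCoeff i j s * seqOpAdj φ q' γ (t i j) k
      = (t i j k * xCoeff i j s * lower β (fun i' => xCoeff i' j p) i
          - ((i : ℂ) + 1) * β i * t (i + 1) j k * (xCoeff i j p * xCoeff (i + 1) j s))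
        + (t i j k * xCoeff i j s * lower φ (fun j' => xCoeff i j' p) j
          - ((j : ℂ) + 1) * φ j * t i (j + 1) k
          * (xCoeff i j p * xCoeff (i + 1) j s - xCoeff i j p * xCoeff i j s))
        - (raise (fun i' => γ (i' + j)) (fun i' => t i' j k) i * (xCoeff i j p * xCoeff i j s)
          - γ (i + j) * t i j k * (xCoeff (i + 1) j p * xCoeff (i + 1) j s))
        + (raise (fun j' => γ (i + j')) (fun j' => t i j' k) j * (xCoeff i j p * xCoeff i j s)
          - γ (i + j) * t i j k * (xCoeff i (j + 1) p * xCoeff i (j + 1) s)) := by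
    intro i j
    rw [hx, ← h₂ i j k, xCoeff_succ_right, xCoeff_succ_right]
    linear_combination (xCoeff i j p * xCoeff (i + 1) j s) * h₁ i j k
  simp only [← Finset.sum_sub_distrib]
  simp only [key, Finset.sum_add_distrib, Finset.sum_sub_distrib]
  rw [hI1, hI2, hI3, hI4]
  ring

/-- By `hS` the operator in p becomes the adjoint in k; summation by parts moves it to the binomial
coefficient, where `hb` turns it into the adjoint in n. -/
lemma seqOp_binomSum
    (hS : ∀ p s k, seqOp β q γ (fun p => fullSum t p s k) p = seqOpAdj φ q' γ (fullSum t p s) k)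
    (hb : ∀ n k, seqOpAdj β q γ (fun n => (n.choose k : ℂ)) n
      = seqOp φ q' γ (fun k => (n.choose k : ℂ)) k)
    (p s n : ℕ) :
    seqOp β q γ (fun p => binomSum t p s n) p = seqOpAdj β q γ (binomSum t p s) n := by
  have hext : ∀ p m, m < n + 3 → binomSum t p s m
      = ∑ k ∈ Finset.range (n + 3), (m.choose k : ℂ) * fullSum t p s k := by
    intro p m hm
    refine Finset.sum_subset (Finset.range_mono (Nat.succ_le_of_lt hm)) fun k _ hk => ?_
    rw [Nat.choose_eq_zero_of_lt (by simpa using hk)]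
    simp
  have hL : seqOp β q γ (fun p => binomSum t p s n) p
      = ∑ k ∈ Finset.range (n + 3), (n.choose k : ℂ) * seqOpAdj φ q' γ (fullSum t p s) k := by
    simp only [← hS]
    rw [← seqOp_sum]
    congr 1
    funext p'
    exact hext p' n (by omega)
  have hR : seqOpAdj β q γ (binomSum t p s) n
      = ∑ k ∈ Finset.range (n + 3), fullSum t p s k
          * seqOp φ q' γ (fun k => (n.choose k : ℂ)) k := by
    rw [seqOpAdj_congr fun m hm => hext p m (by omega)]
    simp only [← hb]
    rw [← seqOpAdj_sum]
    congr 1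
    funext n'
    exact Finset.sum_congr rfl fun _ _ => mul_comm _ _
  have e1 : ∑ k ∈ Finset.range (n + 3), (n.choose k : ℂ) * lower φ (fullSum t p s) k
      = ∑ k ∈ Finset.range (n + 3),
          ((k : ℂ) + 1) * φ k * (n.choose (k + 1) : ℂ) * fullSum t p s k := by
    apply sum_range_shift
    · simp [lower]
    · intro k; simp only [lower]; ring
    · rw [Nat.choose_eq_zero_of_lt (by omega)]; simp
  have e2 : ∑ k ∈ Finset.range (n + 3), raise γ (fun k => (n.choose k : ℂ)) k * fullSum t p s k
      = ∑ k ∈ Finset.range (n + 3), γ k * (n.choose k : ℂ) * fullSum t p s (k + 1) := by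
    apply sum_range_shift
    · simp [raise]
    · intro k; simp only [raise]
    · rw [Nat.choose_eq_zero_of_lt (by omega)]; simp
  rw [hL, hR, ← sub_eq_zero, ← Finset.sum_sub_distrib]
  have key : ∀ k : ℕ, (n.choose k : ℂ) * seqOpAdj φ q' γ (fullSum t p s) k
        - fullSum t p s k * seqOp φ q' γ (fun k => (n.choose k : ℂ)) k
      = ((n.choose k : ℂ) * lower φ (fullSum t p s) k
          - ((k : ℂ) + 1) * φ k * (n.choose (k + 1) : ℂ) * fullSum t p s k)
        - (raise γ (fun k => (n.choose k : ℂ)) k * fullSum t p s k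
          - γ k * (n.choose k : ℂ) * fullSum t p s (k + 1)) := by
    intro k
    simp only [seqOp, seqOpAdj]
    ring
  simp only [key, Finset.sum_sub_distrib]
  rw [e1, e2]
  ring

/-- The equation at p gives row p + 1 from rows p and p - 1, since (p+1) β(p) is invertible. -/
lemma eq_of_seqOp_eq_seqOpAdj (hβ : ∀ n, β n ≠ 0) {u v : ℕ → ℕ → ℂ}
    (hu : ∀ p n, seqOp β q γ (fun p => u p n) p = seqOpAdj β q γ (u p) n)
    (hv : ∀ p n, seqOp β q γ (fun p => v p n) p = seqOpAdj β q γ (v p) n)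
    (h0 : u 0 = v 0) : u = v := by
  funext p
  induction p using Nat.strong_induction_on with
  | _ p ih =>
    rcases p with _ | p
    · exact h0
    funext n
    have hne : ((p : ℂ) + 1) * β p ≠ 0 := mul_ne_zero (cast_add_one_ne p) (hβ p)
    apply mul_left_cancel₀ hne
    have h1 := hu p n
    have h2 := hv p n
    rw [ih p (Nat.lt_succ_self p), ← h2] at h1
    have h3 : raise γ (fun p => u p n) p = raise γ (fun p => v p n) p := by
      rcases p with _ | p
      · rfl
      · simp only [raise, ih p (by omega)]
    simp only [seqOp, h3, ih p (Nat.lt_succ_self p)] at h1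
    linear_combination h1

/-- At x₁ = 0 only i = 0 remains, the two signs (-1)^k cancel, and the sum is the binomial expansion
of x₂^n = ((x₂ - 1) + 1)^n. -/
lemma binomSum_zero (h : ∀ j k, t 0 j k = if k = j then (-1) ^ j else 0) (s n : ℕ) :
    binomSum t 0 s n = if n = s then 1 else 0 := by
  have h1 : ∀ k, fullSum t 0 s k = ((X - 1 : ℂ[X]) ^ k).coeff s := by
    intro k
    have h00 : xCoeff 0 k 0 = (-1) ^ k := by simp [xCoeff, coeff_zero_eq_eval_zero]
    simp only [fullSum, truncSum, zero_add, Finset.sum_range_one, h, ite_mul, zero_mul,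
      Finset.sum_ite_eq, Finset.mem_range, Nat.lt_succ_self, if_true, h00]
    rw [← mul_assoc, ← mul_pow]
    simp [xCoeff]
  have h2 : (X : ℂ[X]) ^ n
      = ∑ k ∈ Finset.range (n + 1), C (n.choose k : ℂ) * (X - 1) ^ k := by
    conv_lhs => rw [show (X : ℂ[X]) = (X - 1) + 1 by ring, add_pow]
    exact Finset.sum_congr rfl fun k _ => by simp [mul_comm]
  have h3 := congrArg (fun r => coeff r s) h2
  simp only [coeff_X_pow, finsetSum_coeff, coeff_C_mul] at h3
  simp only [binomSum, h1, ← h3, eq_comm]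

end Recurrence

lemma cast_choose_succ_right (n k : ℕ) :
    ((k : ℂ) + 1) * (n.choose (k + 1) : ℂ) = ((n : ℂ) - k) * (n.choose k : ℂ) := by
  rcases le_or_gt k n with h | h
  · have := Nat.choose_succ_right_eq n k
    rw [← Nat.cast_sub h]
    exact_mod_cast (by linarith : (k + 1) * n.choose (k + 1) = (n - k) * n.choose k)
  · rw [Nat.choose_eq_zero_of_lt h, Nat.choose_eq_zero_of_lt (by omega)]; simp

lemma cast_choose_succ_left (n k : ℕ) :
    ((n : ℂ) + 1) * (n.choose k : ℂ) = ((n : ℂ) + 1 - k) * ((n + 1).choose k : ℂ) := by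
  rcases k with _ | k
  · simp
  · have h1 := cast_choose_succ_right n k
    have h2 := congrArg (Nat.cast (R := ℂ)) (Nat.choose_succ_succ' n k)
    push_cast at h1 h2 ⊢
    rw [h2]
    linear_combination h1

/-- Both sides are the coefficient of (x-1)^k in D x^n at λ = 0: either D is applied first and the
powers of x are expanded, or the other way round. -/
lemma seqOpAdj_choose (a₁ a₂ a₃ a₄ a₅ a₆ : ℂ) (n k : ℕ) :
    seqOpAdj (fun n => symbolDown a₁ a₃ n) (fun n => symbolMid a₁ a₂ a₄ n)
        (fun n => symbolUp a₂ a₅ a₆ n) (fun n => (n.choose k : ℂ)) n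
      = seqOp (fun n => symbolOne a₁ a₂ a₃ a₄ a₅ (n + 1 : ℕ))
        (fun n => symbolOneMid a₁ a₂ a₄ a₅ a₆ n)
        (fun n => symbolUp a₂ a₅ a₆ n) (fun k => (n.choose k : ℂ)) k := by
  have hl : lower (fun n => symbolDown a₁ a₃ n) (fun n => (n.choose k : ℂ)) n
      = ((n : ℂ) - k) * symbolDown a₁ a₃ (n - 1) * (n.choose k : ℂ) := by
    rcases n with _ | n
    · rcases k with _ | k <;> simp [lower]
    · simp only [lower]
      push_cast
      rw [add_sub_cancel_right]
      linear_combination symbolDown a₁ a₃ n * cast_choose_succ_left n k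
  have hu : symbolUp a₂ a₅ a₆ n * ((n + 1).choose k : ℂ)
      = raise (fun n => symbolUp a₂ a₅ a₆ n) (fun k => (n.choose k : ℂ)) k
        + symbolUp a₂ a₅ a₆ n * (n.choose k : ℂ)
        + symbolUpDiff a₂ a₅ n (k - 1) * (k * (n.choose k : ℂ)) := by
    rcases k with _ | k
    · simp [raise]
    · have h1 := cast_choose_succ_right n k
      have h2 := congrArg (Nat.cast (R := ℂ)) (Nat.choose_succ_succ' n k)
      push_cast at h1 h2 ⊢
      simp only [h2, h1, raise, symbolUp, symbolUpDiff]
      ring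
  have hr := cast_choose_succ_right n k
  simp only [seqOpAdj, seqOp, hl, hu]
  simp only [symbolDown, symbolMid, symbolUp, symbolUpDiff, symbolOne, symbolOneMid]
  push_cast
  linear_combination -(a₃ + a₄ + a₅ + k * (a₁ + a₂) + k * ((k : ℂ) - 1)) * hr

/-! ### The balance of neighbouring coefficients for the symbols of D. -/

section Triple

variable (a₁ a₂ a₃ a₄ a₅ a₆ : ℂ)

/-- `tripleSeq` for the symbols of `D`. -/
def opTriple : ℕ → ℕ → ℕ → ℂ :=
  tripleSeq (fun n => symbolDown a₁ a₃ n) (fun n => symbolOne a₁ a₂ a₃ a₄ a₅ n)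
    (fun n => symbolUp a₂ a₅ a₆ n)

lemma opTriple_balance (hβ : ∀ n : ℕ, symbolDown a₁ a₃ n ≠ 0) (i j k : ℕ) :
    -(((j : ℂ) + 1) * symbolOne a₁ a₂ a₃ a₄ a₅ (j + 1 : ℕ)
          * opTriple a₁ a₂ a₃ a₄ a₅ a₆ i (j + 1) k)
        + raise (fun i' => symbolUp a₂ a₅ a₆ (i' + j : ℕ))
            (fun i' => opTriple a₁ a₂ a₃ a₄ a₅ a₆ i' j k) i
        - raise (fun j' => symbolUp a₂ a₅ a₆ (i + j' : ℕ))
            (fun j' => opTriple a₁ a₂ a₃ a₄ a₅ a₆ i j' k) j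
        + symbolUp a₂ a₅ a₆ (i + j : ℕ) * opTriple a₁ a₂ a₃ a₄ a₅ a₆ i j k
        + symbolCross a₁ a₂ a₄ a₅ a₆ i j * opTriple a₁ a₂ a₃ a₄ a₅ a₆ i j k
      = seqOpAdj (fun n => symbolOne a₁ a₂ a₃ a₄ a₅ (n + 1 : ℕ))
          (fun n => symbolOneMid a₁ a₂ a₄ a₅ a₆ n) (fun n => symbolUp a₂ a₅ a₆ n)
          (opTriple a₁ a₂ a₃ a₄ a₅ a₆ i j) k := by
  set t := opTriple a₁ a₂ a₃ a₄ a₅ a₆ with ht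
  have hU : raise (fun i' => symbolUp a₂ a₅ a₆ (i' + j : ℕ)) (fun i' => t i' j k) i
      = ((i : ℂ) + j - k) * symbolDown a₁ a₃ (i - 1) * t i j k := by
    rcases i with _ | i
    · have := tripleSeq_zero_left_mul (β := fun n => symbolDown a₁ a₃ n)
        (φ := fun n => symbolOne a₁ a₂ a₃ a₄ a₅ n) (γ := fun n => symbolUp a₂ a₅ a₆ n) j k
      simp only [raise]
      rw [ht, opTriple]
      push_cast
      linear_combination -symbolDown a₁ a₃ (0 - 1) * this
    · have := tripleSeq_succ_left (β := fun n => symbolDown a₁ a₃ n)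
        (φ := fun n => symbolOne a₁ a₂ a₃ a₄ a₅ n) (γ := fun n => symbolUp a₂ a₅ a₆ n) hβ i j k
      simp only [raise]
      rw [ht, opTriple]
      push_cast at this ⊢
      rw [this, add_sub_cancel_right]
  have hV : raise (fun j' => symbolUp a₂ a₅ a₆ (i + j' : ℕ)) (fun j' => t i j' k) j
      = -(symbolUp a₂ a₅ a₆ k * t i j (k + 1))
        + ((i : ℂ) + j - k) * symbolOneDiff a₁ a₂ a₃ a₄ a₅ j (k + 1) * t i j k := by
    rcases j with _ | j
    · have := tripleSeq_diag_zero (β := fun n => symbolDown a₁ a₃ n)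
        (φ := fun n => symbolOne a₁ a₂ a₃ a₄ a₅ n) (γ := fun n => symbolUp a₂ a₅ a₆ n) i k
      have h2 : symbolOneDiff a₁ a₂ a₃ a₄ a₅ 0 (k + 1) = symbolOne a₁ a₂ a₃ a₄ a₅ (k + 1) := by
        simp only [symbolOneDiff, symbolOne]; ring
      simp only [raise]
      rw [ht, opTriple]
      push_cast at this ⊢
      rw [h2]
      linear_combination this
    · have := tripleSeq_diag (β := fun n => symbolDown a₁ a₃ n)
        (φ := fun n => symbolOne a₁ a₂ a₃ a₄ a₅ n) (γ := fun n => symbolUp a₂ a₅ a₆ n)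
        (ψ := fun x y => symbolOneDiff a₁ a₂ a₃ a₄ a₅ x y) hβ
        (fun x y => by simp only [symbolOneDiff, symbolOne]; ring) i j k
      simp only [raise]
      rw [ht, opTriple]
      push_cast at this ⊢
      linear_combination this
  -- The neighbours in `hV` and `hW` are grouped in pairs because only the pairs are polynomial
  -- multiples of t_{ijk}.
  have hW : ((j : ℂ) + 1) * symbolOne a₁ a₂ a₃ a₄ a₅ (j + 1 : ℕ) * t i (j + 1) k
        + lower (fun n => symbolOne a₁ a₂ a₃ a₄ a₅ (n + 1 : ℕ)) (t i j) k
      = -(((k : ℂ) - j) * symbolUpDiff a₂ a₅ (i + j) (k - 1) * t i j k) := by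
    rcases k with _ | k
    · rw [ht, opTriple, tripleSeq_of_lt (j := j + 1) (Nat.succ_pos j)]
      rcases j with _ | j
      · simp [lower]
      · rw [tripleSeq_of_lt (Nat.succ_pos j)]
        simp [lower]
    · have := tripleSeq_right_add_mid (β := fun n => symbolDown a₁ a₃ n)
        (φ := fun n => symbolOne a₁ a₂ a₃ a₄ a₅ n) (γ := fun n => symbolUp a₂ a₅ a₆ n)
        (χ := fun x y => symbolUpDiff a₂ a₅ x y) hβ
        (fun x y => by simp only [symbolUpDiff, symbolUp]; ring) i j k
      simp only [lower]
      rw [ht, opTriple]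
      push_cast at this ⊢
      rw [add_sub_cancel_right]
      linear_combination this
  rw [hU, hV, seqOpAdj]
  -- With all neighbours eliminated, the total factor of t_{ijk} vanishes identically.
  have hP : ((k : ℂ) - j) * symbolUpDiff a₂ a₅ (i + j) (k - 1)
      + ((i : ℂ) + j - k) * (symbolDown a₁ a₃ (i - 1) - symbolOneDiff a₁ a₂ a₃ a₄ a₅ j (k + 1))
      + symbolUp a₂ a₅ a₆ (i + j) + symbolCross a₁ a₂ a₄ a₅ a₆ i j
      - symbolOneMid a₁ a₂ a₄ a₅ a₆ k = 0 := by
    simp only [symbolDown, symbolUp, symbolUpDiff, symbolOneDiff, symbolOneMid, symbolCross]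
    ring
  push_cast at hW ⊢
  linear_combination -hW + t i j k * hP

lemma seqOp_binomSum_opTriple (hβ : ∀ n : ℕ, symbolDown a₁ a₃ n ≠ 0) (p s n : ℕ) :
    seqOp (fun n => symbolDown a₁ a₃ n) (fun n => symbolMid a₁ a₂ a₄ n)
        (fun n => symbolUp a₂ a₅ a₆ n)
        (fun p => binomSum (opTriple a₁ a₂ a₃ a₄ a₅ a₆) p s n) p
      = seqOpAdj (fun n => symbolDown a₁ a₃ n) (fun n => symbolMid a₁ a₂ a₄ n)
        (fun n => symbolUp a₂ a₅ a₆ n) (binomSum (opTriple a₁ a₂ a₃ a₄ a₅ a₆) p s) n := by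
  refine seqOp_binomSum (fun p s k => seqOp_fullSum (fun i j k h => tripleSeq_of_lt h)
    (seqOp_xCoeff a₁ a₂ a₃ a₄ a₅ a₆) (fun i j k => ?_)
    (opTriple_balance a₁ a₂ a₃ a₄ a₅ a₆ hβ) p s k) (seqOpAdj_choose a₁ a₂ a₃ a₄ a₅ a₆) p s n
  exact tripleSeq_left_add_right (β := fun n => symbolDown a₁ a₃ n)
    (φ := fun n => symbolOne a₁ a₂ a₃ a₄ a₅ n) hβ i j k

end Triple


/-! ### The polynomials P_n and their structure constants. -/

section PolynomialSequence

variable {β q γ : ℕ → ℂ}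

/-- The polynomials `P n` with `P 0 = 1` and
`(n + 1) * β n * P (n + 1) + (q n + X) * P n + γ (n - 1) * P (n - 1) = 0`. -/
def recPoly (β q γ : ℕ → ℂ) : ℕ → ℂ[X]
  | 0 => 1
  | 1 => C (-(β 0)⁻¹) * (X + C (q 0))
  | n + 2 => C (-((((n + 1 : ℕ) : ℂ) + 1) * β (n + 1))⁻¹)
      * ((X + C (q (n + 1))) * recPoly β q γ (n + 1) + C (γ n) * recPoly β q γ n)

lemma recPoly_succ_succ (n : ℕ) :
    recPoly β q γ (n + 2) = C (-((((n + 1 : ℕ) : ℂ) + 1) * β (n + 1))⁻¹)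
      * ((X + C (q (n + 1))) * recPoly β q γ (n + 1) + C (γ n) * recPoly β q γ n) := rfl

lemma X_mul_recPoly_zero (hβ : ∀ n, β n ≠ 0) :
    X * recPoly β q γ 0
      = -(C (β 0) * recPoly β q γ 1 + C (q 0) * recPoly β q γ 0) := by
  have h : C (β 0) * C (-(β 0)⁻¹) = (-1 : ℂ[X]) := by
    rw [← C_mul, mul_neg, mul_inv_cancel₀ (hβ 0)]; simp
  simp only [recPoly]
  linear_combination (X + C (q 0)) * h

lemma X_mul_recPoly_succ (hβ : ∀ n, β n ≠ 0) (n : ℕ) :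
    X * recPoly β q γ (n + 1)
      = -(C ((((n + 1 : ℕ) : ℂ) + 1) * β (n + 1)) * recPoly β q γ (n + 2)
        + C (q (n + 1)) * recPoly β q γ (n + 1) + C (γ n) * recPoly β q γ n) := by
  have hne : (((n + 1 : ℕ) : ℂ) + 1) * β (n + 1) ≠ 0 := mul_ne_zero (cast_add_one_ne _) (hβ _)
  have h : C ((((n + 1 : ℕ) : ℂ) + 1) * β (n + 1)) * C (-((((n + 1 : ℕ) : ℂ) + 1) * β (n + 1))⁻¹)
      = (-1 : ℂ[X]) := by
    rw [← C_mul, mul_neg, mul_inv_cancel₀ hne]; simp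
  rw [recPoly_succ_succ]
  linear_combination
    ((X + C (q (n + 1))) * recPoly β q γ (n + 1) + C (γ n) * recPoly β q γ n) * h

lemma degree_recPoly (hβ : ∀ n, β n ≠ 0) (n : ℕ) : (recPoly β q γ n).degree = n := by
  induction n using Nat.strong_induction_on with
  | _ n ih =>
    match n with
    | 0 => simp [recPoly]
    | 1 =>
      rw [recPoly, degree_mul, degree_C (neg_ne_zero.2 (inv_ne_zero (hβ 0))), degree_X_add_C]
      rfl
    | n + 2 =>
      have hne : (((n + 1 : ℕ) : ℂ) + 1) * β (n + 1) ≠ 0 :=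
        mul_ne_zero (cast_add_one_ne _) (hβ _)
      have h1 : ((X + C (q (n + 1))) * recPoly β q γ (n + 1)).degree = ((n + 2 : ℕ) : WithBot ℕ) := by
        rw [degree_mul, degree_X_add_C, ih (n + 1) (by omega), add_comm]
        rfl
      have h2 : (C (γ n) * recPoly β q γ n).degree
          < ((X + C (q (n + 1))) * recPoly β q γ (n + 1)).degree := by
        rw [h1]
        calc (C (γ n) * recPoly β q γ n).degree ≤ (recPoly β q γ n).degree := by
              rw [degree_mul]
              exact (add_le_add_left degree_C_le _).trans (by simp)
          _ = ((n : ℕ) : WithBot ℕ) := ih n (by omega)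
          _ < ((n + 2 : ℕ) : WithBot ℕ) := by exact_mod_cast (by omega : n < n + 2)
      rw [recPoly_succ_succ, degree_mul, degree_C (neg_ne_zero.2 (inv_ne_zero hne)),
        degree_add_eq_left_of_degree_lt h2, h1, zero_add]

/-- The basis of `ℂ[X]` given by `recPoly`. -/
def recBasis (q γ : ℕ → ℂ) (hβ : ∀ n, β n ≠ 0) : Module.Basis ℕ ℂ ℂ[X] :=
  Polynomial.Sequence.basis ⟨recPoly β q γ, degree_recPoly hβ⟩ fun i => by
    refine isUnit_iff_ne_zero.2 (leadingCoeff_ne_zero.2 ?_)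
    intro h
    have := degree_recPoly (q := q) (γ := γ) hβ i
    rw [show recPoly β q γ i = 0 from h] at this
    simp at this

lemma recBasis_apply (hβ : ∀ n, β n ≠ 0) (i : ℕ) :
    recBasis q γ hβ i = recPoly β q γ i :=
  Polynomial.Sequence.basis_eq_self _ _ _

lemma seqOp_eval_recPoly (hβ : ∀ n, β n ≠ 0) (lam : ℂ) (n : ℕ) :
    seqOp β q γ (fun n => (recPoly β q γ n).eval lam) n + lam * (recPoly β q γ n).eval lam
      = 0 := by
  rcases n with _ | n
  · have := congrArg (eval lam) (X_mul_recPoly_zero (q := q) (γ := γ) hβ)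
    simp only [eval_mul, eval_X, eval_neg, eval_add, eval_C] at this
    simp only [seqOp, raise, Nat.cast_zero, zero_add, one_mul, add_zero]
    linear_combination this
  · have := congrArg (eval lam) (X_mul_recPoly_succ (q := q) (γ := γ) hβ n)
    simp only [eval_mul, eval_X, eval_neg, eval_add, eval_C] at this
    simp only [seqOp, raise]
    linear_combination this

/-- The recurrence lists the columns of the matrix of multiplication by X in the basis; both sides
are linear in F, so the basis vectors suffice. -/
lemma repr_X_mul (hβ : ∀ n, β n ≠ 0) (F : ℂ[X]) (n : ℕ) :
    (recBasis q γ hβ).repr (X * F) n = -seqOpAdj β q γ ((recBasis q γ hβ).repr F) n := by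
  set B := recBasis q γ hβ with hB
  let φ₁ : ℂ[X] →ₗ[ℂ] ℂ := (Finsupp.lapply n) ∘ₗ B.repr.toLinearMap ∘ₗ LinearMap.mulLeft ℂ X
  let φ₂ : ℂ[X] →ₗ[ℂ] ℂ :=
    { toFun := fun F => -seqOpAdj β q γ (B.repr F) n
      map_add' := fun F G => by
        rcases n with _ | n <;>
        · simp only [seqOpAdj, lower, map_add, Finsupp.add_apply]; ring
      map_smul' := fun a F => by
        rcases n with _ | n <;>
        · simp only [seqOpAdj, lower, map_smul, Finsupp.smul_apply, smul_eq_mul,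
            RingHom.id_apply]
          ring }
  suffices h : φ₁ = φ₂ from LinearMap.congr_fun h F
  refine B.ext fun m => ?_
  change B.repr (X * B m) n = -seqOpAdj β q γ (B.repr (B m)) n
  have hm : ∀ m, recPoly β q γ m = B m := fun m => (recBasis_apply hβ m).symm
  rcases m with _ | m
  · rw [← hm, X_mul_recPoly_zero hβ, hm, hm]
    simp only [← smul_eq_C_mul, map_neg, map_add, map_smul, B.repr_self]
    rcases n with _ | _ | n <;> simp [seqOpAdj, lower]
  · rw [← hm, X_mul_recPoly_succ hβ, hm, hm, hm]
    simp only [← smul_eq_C_mul, map_neg, map_add, map_smul, B.repr_self]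
    rcases n with _ | n
    · rcases m with _ | m <;> simp [seqOpAdj, lower]
    · simp only [seqOpAdj, lower, Finsupp.neg_apply, Finsupp.add_apply, Finsupp.smul_apply,
        Finsupp.single_apply, smul_eq_mul, add_left_inj]
      rcases lt_trichotomy n m with h | rfl | h
      · rcases (Nat.succ_le_of_lt h).eq_or_lt with rfl | h'
        · simp [show ¬ n + 1 + 1 = n by omega]
        · simp [show ¬ m + 1 = n by omega, show ¬ m = n by omega,
            show ¬ m = n + 1 by omega]
      · simp
      · rcases (Nat.succ_le_of_lt h).eq_or_lt with rfl | h'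
        · simp [show ¬ m = m + 1 + 1 by omega]
        · simp [show ¬ m + 1 = n by omega, show ¬ m = n by omega,
            show ¬ m = n + 1 by omega]

/-- Associativity: X (P_p P_s) is expanded by `repr_X_mul`, and (X P_p) P_s by the recurrence in p.
-/
lemma seqOp_structureConst (hβ : ∀ n, β n ≠ 0) (p s n : ℕ) :
    seqOp β q γ (fun p => structureConst (recBasis q γ hβ) p s n) p
      = seqOpAdj β q γ (structureConst (recBasis q γ hβ) p s) n := by
  set B := recBasis q γ hβ with hB
  have hm : ∀ m, recPoly β q γ m = B m := fun m => (recBasis_apply hβ m).symm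
  have h1 := repr_X_mul (q := q) (γ := γ) hβ (B p * B s) n
  rw [← neg_eq_iff_eq_neg] at h1
  refine Eq.trans ?_ h1
  simp only [structureConst]
  rw [← mul_assoc]
  rcases p with _ | p
  · have := X_mul_recPoly_zero (q := q) (γ := γ) hβ
    rw [hm, hm] at this
    rw [this]
    simp only [neg_mul, add_mul, ← smul_eq_C_mul, map_neg, map_add]
    simp [seqOp, raise, ← hB]
  · have := X_mul_recPoly_succ (q := q) (γ := γ) hβ p
    rw [hm, hm, hm] at this
    rw [this]
    simp only [neg_mul, add_mul, ← smul_eq_C_mul, map_neg, map_add]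
    simp [seqOp, raise, ← hB]
    ring

lemma structureConst_zero (hβ : ∀ n, β n ≠ 0) (s n : ℕ) :
    structureConst (recBasis q γ hβ) 0 s n = if n = s then 1 else 0 := by
  rw [structureConst, recBasis_apply, recPoly, one_mul, Module.Basis.repr_self,
    Finsupp.single_apply]
  simp [eq_comm]

lemma eq_of_seqOp_add_eq_zero (hβ : ∀ n, β n ≠ 0) {lam : ℂ} {u v : ℕ → ℂ}
    (hu : ∀ n, seqOp β q γ u n + lam * u n = 0) (hv : ∀ n, seqOp β q γ v n + lam * v n = 0)
    (h0 : u 0 = v 0) : u = v := by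
  funext p
  induction p using Nat.strong_induction_on with
  | _ p ih =>
    rcases p with _ | p
    · exact h0
    have hne : ((p : ℂ) + 1) * β p ≠ 0 := mul_ne_zero (cast_add_one_ne p) (hβ p)
    apply mul_left_cancel₀ hne
    have h1 := hu p
    have h2 := hv p
    have h3 : raise γ u p = raise γ v p := by
      rcases p with _ | p
      · rfl
      · simp only [raise, ih p (by omega)]
    simp only [seqOp, h3, ih p (Nat.lt_succ_self p)] at h1 h2
    linear_combination h1 - h2

end PolynomialSequence

/-! ### Geometric bounds for solutions of the recurrence. -/

section Growth

lemma exists_le_norm_add_natCast {b : ℂ} (hb : ∀ n : ℕ, b + n ≠ 0) :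
    ∃ K : ℝ, 0 ≤ K ∧ ∀ n : ℕ, (n : ℝ) + 1 ≤ K * ‖b + n‖ := by
  have h1 : Filter.Tendsto (fun n : ℕ => ‖b + n‖) Filter.atTop Filter.atTop := by
    refine Filter.tendsto_atTop_mono (f := fun n : ℕ => (n : ℝ) + -‖b‖) (fun n => ?_)
      (Filter.tendsto_atTop_add_const_right _ _ tendsto_natCast_atTop_atTop)
    have := norm_sub_le (b + n) b
    rw [add_sub_cancel_left, Complex.norm_natCast] at this
    linarith
  obtain ⟨M, hM⟩ := (tendsto_inv_atTop_zero.comp h1).bddAbove_range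
  have hM' : ∀ n : ℕ, ‖b + n‖⁻¹ ≤ M := fun n => hM ⟨n, rfl⟩
  have hM0 : 0 ≤ M := (inv_nonneg.2 (norm_nonneg _)).trans (hM' 0)
  -- From n + 1 ≤ ‖b + n‖ + (‖b‖ + 1) and 1 ≤ M ‖b + n‖.
  refine ⟨1 + (‖b‖ + 1) * M, by positivity, fun n => ?_⟩
  have hpos : 0 < ‖b + n‖ := norm_pos_iff.2 (hb n)
  have h2 : 1 ≤ M * ‖b + n‖ := by
    have := hM' n
    rwa [inv_le_iff_one_le_mul₀ hpos] at this
  have h3 : (n : ℝ) ≤ ‖b + n‖ + ‖b‖ := by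
    have := norm_sub_le (b + n) b
    rwa [add_sub_cancel_left, Complex.norm_natCast] at this
  nlinarith [norm_nonneg b]

lemma norm_cubic_le (e₀ e₁ e₂ e₃ : ℂ) (n : ℕ) :
    ‖e₀ + e₁ * n + e₂ * n ^ 2 + e₃ * n ^ 3‖
      ≤ (‖e₀‖ + ‖e₁‖ + ‖e₂‖ + ‖e₃‖) * ((n : ℝ) + 1) ^ 3 := by
  have hn : (0 : ℝ) ≤ n := Nat.cast_nonneg n
  have h0 : (1 : ℝ) ≤ ((n : ℝ) + 1) ^ 3 := one_le_pow₀ (by linarith)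
  have h1 : (n : ℝ) ≤ ((n : ℝ) + 1) ^ 3 := by nlinarith [pow_nonneg hn 2, pow_nonneg hn 3]
  have h2 : (n : ℝ) ^ 2 ≤ ((n : ℝ) + 1) ^ 3 := by nlinarith [pow_nonneg hn 2, pow_nonneg hn 3]
  have h3 : (n : ℝ) ^ 3 ≤ ((n : ℝ) + 1) ^ 3 := pow_le_pow_left₀ hn (by linarith) 3
  calc ‖e₀ + e₁ * n + e₂ * n ^ 2 + e₃ * n ^ 3‖
      ≤ ‖e₀‖ + ‖e₁ * n‖ + ‖e₂ * n ^ 2‖ + ‖e₃ * n ^ 3‖ := by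
        refine (norm_add_le _ _).trans (add_le_add_left ?_ _)
        refine (norm_add_le _ _).trans (add_le_add_left ?_ _)
        exact norm_add_le _ _
    _ = ‖e₀‖ * 1 + ‖e₁‖ * n + ‖e₂‖ * n ^ 2 + ‖e₃‖ * n ^ 3 := by simp
    _ ≤ ‖e₀‖ * ((n : ℝ) + 1) ^ 3 + ‖e₁‖ * ((n : ℝ) + 1) ^ 3 + ‖e₂‖ * ((n : ℝ) + 1) ^ 3
        + ‖e₃‖ * ((n : ℝ) + 1) ^ 3 := by gcongr
    _ = _ := by ring

lemma exists_norm_le_pow {β q γ u : ℕ → ℂ} {lam : ℂ} {A K : ℝ}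
    (hβ : ∀ n : ℕ, ((n : ℝ) + 1) ^ 2 ≤ K * ‖β n‖)
    (hq : ∀ n : ℕ, ‖q n + lam‖ ≤ A * ((n : ℝ) + 1) ^ 3)
    (hγ : ∀ n : ℕ, ‖γ n‖ ≤ A * ((n : ℝ) + 1) ^ 3)
    (hu : ∀ n, seqOp β q γ u n + lam * u n = 0) (h0 : u 0 = 1) :
    ∃ M : ℝ, 0 < M ∧ ∀ n, ‖u n‖ ≤ M ^ n := by
  have hA : 0 ≤ A := by simpa using (norm_nonneg _).trans (hγ 0)
  have hK : 0 < K := by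
    have := hβ 0
    by_contra! h
    have h1 := mul_nonpos_of_nonpos_of_nonneg h (norm_nonneg (β 0))
    norm_num at this
    linarith
  -- At n = 0 the truncated index gives u 0, which is harmless because `raise` vanishes there.
  have hstep : ∀ n, ‖u (n + 1)‖ ≤ K * A * (‖u n‖ + ‖u (n - 1)‖) := by
    intro n
    have hr : ‖raise γ u n‖ ≤ A * ((n : ℝ) + 1) ^ 3 * ‖u (n - 1)‖ := by
      rcases n with _ | n
      · simp only [raise, norm_zero]; positivity
      · simp only [raise, norm_mul, Nat.add_sub_cancel]
        have h1 : ‖γ n‖ ≤ A * (((n + 1 : ℕ) : ℝ) + 1) ^ 3 := by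
          refine (hγ n).trans ?_
          push_cast
          gcongr
          linarith
        gcongr
    have h1 : ((n : ℂ) + 1) * β n * u (n + 1) = -((q n + lam) * u n + raise γ u n) := by
      have := hu n
      simp only [seqOp] at this
      linear_combination this
    have h2 : ((n : ℝ) + 1) * ‖β n‖ * ‖u (n + 1)‖
        ≤ A * ((n : ℝ) + 1) ^ 3 * (‖u n‖ + ‖u (n - 1)‖) := by
      have h3 : ‖(n : ℂ) + 1‖ = (n : ℝ) + 1 := by
        exact_mod_cast Complex.norm_natCast (n + 1)
      calc ((n : ℝ) + 1) * ‖β n‖ * ‖u (n + 1)‖ = ‖((n : ℂ) + 1) * β n * u (n + 1)‖ := by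
            rw [norm_mul, norm_mul, h3]
        _ ≤ ‖q n + lam‖ * ‖u n‖ + ‖raise γ u n‖ := by
            rw [h1, norm_neg, ← norm_mul]
            exact norm_add_le _ _
        _ ≤ A * ((n : ℝ) + 1) ^ 3 * ‖u n‖ + A * ((n : ℝ) + 1) ^ 3 * ‖u (n - 1)‖ :=
            add_le_add (mul_le_mul_of_nonneg_right (hq n) (norm_nonneg _)) hr
        _ = _ := by ring
    have hn : (0 : ℝ) < ((n : ℝ) + 1) ^ 3 := by positivity
    refine le_of_mul_le_mul_left ?_ hn
    calc ((n : ℝ) + 1) ^ 3 * ‖u (n + 1)‖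
        = ((n : ℝ) + 1) ^ 2 * (((n : ℝ) + 1) * ‖u (n + 1)‖) := by ring
      _ ≤ K * ‖β n‖ * (((n : ℝ) + 1) * ‖u (n + 1)‖) := by
          gcongr
          exact hβ n
      _ = K * (((n : ℝ) + 1) * ‖β n‖ * ‖u (n + 1)‖) := by ring
      _ ≤ K * (A * ((n : ℝ) + 1) ^ 3 * (‖u n‖ + ‖u (n - 1)‖)) := by gcongr
      _ = _ := by ring
  have hKA : 0 ≤ K * A := by positivity
  -- The summand 1 makes the ratio at least 1, so the bound for u (n - 1) is absorbed in the one for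
  -- u n.
  refine ⟨2 * (K * A) + 1, by positivity, fun n => ?_⟩
  set M := 2 * (K * A) + 1 with hM
  have hM1 : 1 ≤ M := by linarith
  induction n using Nat.strong_induction_on with
  | _ n ih =>
    rcases n with _ | n
    · simp [h0]
    · have h1 := ih n (Nat.lt_succ_self n)
      have h2 : ‖u (n - 1)‖ ≤ M ^ n :=
        (ih (n - 1) (by omega)).trans (pow_le_pow_right₀ hM1 (Nat.sub_le n 1))
      calc ‖u (n + 1)‖ ≤ K * A * (‖u n‖ + ‖u (n - 1)‖) := hstep n
        _ ≤ K * A * (M ^ n + M ^ n) := by gcongr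
        _ = (M - 1) * M ^ n := by rw [hM]; ring
        _ ≤ M * M ^ n := by gcongr; linarith
        _ = M ^ (n + 1) := by ring

end Growth

/-! ### Passage between analytic germs at 0 and formal power series. -/

section Taylor

/-- `f` is analytic at `0` and `F` is its Taylor series. -/
def HasTaylor (f : ℂ → ℂ) (F : PowerSeries ℂ) : Prop :=
  AnalyticAt ℂ f 0 ∧ ∀ n, iteratedDeriv n f 0 = n.factorial * PowerSeries.coeff n F

variable {f g : ℂ → ℂ} {F G : PowerSeries ℂ}

lemma AnalyticAt.exists_hasTaylor (hf : AnalyticAt ℂ f 0) : ∃ F, HasTaylor f F := by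
  refine ⟨PowerSeries.mk fun n => iteratedDeriv n f 0 / n.factorial, hf, fun n => ?_⟩
  rw [PowerSeries.coeff_mk, mul_div_cancel₀ _ (cast_factorial_ne n)]

lemma HasTaylor.add (hf : HasTaylor f F) (hg : HasTaylor g G) :
    HasTaylor (fun x => f x + g x) (F + G) := by
  refine ⟨hf.1.add hg.1, fun n => ?_⟩
  rw [iteratedDeriv_fun_add hf.1.contDiffAt hg.1.contDiffAt, hf.2, hg.2, map_add]
  ring

lemma HasTaylor.mul (hf : HasTaylor f F) (hg : HasTaylor g G) :
    HasTaylor (fun x => f x * g x) (F * G) := by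
  refine ⟨hf.1.mul hg.1, fun n => ?_⟩
  rw [iteratedDeriv_fun_mul hf.1.contDiffAt hg.1.contDiffAt, PowerSeries.coeff_mul,
    Finset.Nat.sum_antidiagonal_eq_sum_range_succ
      (fun i j => PowerSeries.coeff i F * PowerSeries.coeff j G), Finset.mul_sum]
  refine Finset.sum_congr rfl fun i hi => ?_
  have := Nat.choose_mul_factorial_mul_factorial (Nat.lt_succ_iff.1 (Finset.mem_range.1 hi))
  rw [hf.2, hg.2, ← this]
  push_cast
  ring

lemma hasTaylor_const (a : ℂ) : HasTaylor (fun _ => a) (PowerSeries.C a) := by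
  refine ⟨analyticAt_const, fun n => ?_⟩
  rw [iteratedDeriv_const, PowerSeries.coeff_C]
  rcases n with _ | n <;> simp

lemma hasTaylor_id : HasTaylor (fun x => x) PowerSeries.X := by
  refine ⟨analyticAt_id, fun n => ?_⟩
  rw [iteratedDeriv_fun_id_zero, PowerSeries.coeff_X]
  split_ifs with h
  · simp [h]
  · simp

lemma HasTaylor.pow (hf : HasTaylor f F) (n : ℕ) : HasTaylor (fun x => f x ^ n) (F ^ n) := by
  induction n with
  | zero => simpa using hasTaylor_const 1
  | succ n ih => simpa only [pow_succ] using ih.mul hf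

lemma HasTaylor.sub_const (hf : HasTaylor f F) (a : ℂ) :
    HasTaylor (fun x => f x - a) (F - PowerSeries.C a) := by
  simpa only [sub_eq_add_neg, map_neg] using hf.add (hasTaylor_const (-a))

lemma HasTaylor.sub (hf : HasTaylor f F) (hg : HasTaylor g G) :
    HasTaylor (fun x => f x - g x) (F - G) := by
  have := hf.add ((hasTaylor_const (-1)).mul hg)
  simpa [sub_eq_add_neg] using this

lemma HasTaylor.deriv (hf : HasTaylor f F) :
    HasTaylor (_root_.deriv f) (PowerSeries.derivative ℂ F) := by
  refine ⟨hf.1.deriv, fun n => ?_⟩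
  rw [← iteratedDeriv_succ', hf.2, PowerSeries.coeff_derivative, Nat.factorial_succ]
  push_cast
  ring

/-- This carries the differential equation to the recurrence and back, and turns equality of Taylor
series into equality of germs. -/
lemma HasTaylor.eq_zero_iff (hf : HasTaylor f F) : F = 0 ↔ ∀ᶠ x in 𝓝 (0 : ℂ), f x = 0 := by
  constructor
  · rintro rfl
    have h := AnalyticAt.hasFPowerSeriesAt hf.1
    have h0 : (fun n => iteratedDeriv n f 0 / n.factorial) = (0 : ℕ → ℂ) := by
      funext n; simp [hf.2]
    rw [h0, FormalMultilinearSeries.ofScalars_series_eq_zero_of_scalar_zero] at h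
    exact h.eventually_eq_zero
  · intro h
    ext n
    have h1 : f =ᶠ[𝓝 0] fun _ => (0 : ℂ) := h
    have h2 := h1.iteratedDeriv_eq n
    rw [hf.2, iteratedDeriv_const] at h2
    have h3 : (n.factorial : ℂ) * PowerSeries.coeff n F = 0 := by
      rw [h2]; simp
    simpa using (mul_eq_zero.1 h3).resolve_left (cast_factorial_ne n)

lemma HasTaylor.coeff_zero (hf : HasTaylor f F) : PowerSeries.coeff 0 F = f 0 := by
  simpa using (hf.2 0).symm

lemma HasTaylor.diffOp (hf : HasTaylor f F) (a₁ a₂ a₃ a₄ a₅ a₆ lam : ℂ) :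
    HasTaylor (diffOp a₁ a₂ a₃ a₄ a₅ a₆ lam f) (formalOp a₁ a₂ a₃ a₄ a₅ a₆ lam F) := by
  have h1 := hf.deriv
  have h2 := h1.deriv
  have h3 := h2.deriv
  have hx := hasTaylor_id
  have hx1 := hx.sub_const 1
  have e2 : iteratedDeriv 2 f = _root_.deriv (_root_.deriv f) := by
    simp [iteratedDeriv_succ]
  have e3 : iteratedDeriv 3 f = _root_.deriv (_root_.deriv (_root_.deriv f)) := by
    simp [iteratedDeriv_succ]
  have := (((((hx.pow 2).mul (hx1.pow 2)).mul h3).add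
    (((hx.mul hx1).mul ((hasTaylor_const a₁).add ((hasTaylor_const a₂).mul hx))).mul h2)).add
    ((((hasTaylor_const a₃).add ((hasTaylor_const a₄).mul hx)).add
      ((hasTaylor_const a₅).mul (hx.pow 2))).mul h1)).add
    ((((hasTaylor_const a₆).mul hx).add (hasTaylor_const lam)).mul hf)
  rw [map_one] at this
  unfold ThirdOrderKernel.diffOp
  rw [e2, e3]
  exact this

lemma exists_hasTaylor_hasSum {u : ℕ → ℂ} {M : ℝ} (hM : 0 < M) (hu : ∀ n, ‖u n‖ ≤ M ^ n) :
    ∃ f : ℂ → ℂ, HasTaylor f (PowerSeries.mk u) ∧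
      ∀ᶠ x in 𝓝 (0 : ℂ), HasSum (fun n => u n * x ^ n) (f x) := by
  set p := FormalMultilinearSeries.ofScalars ℂ u with hp
  -- The bound M^n gives radius of convergence at least 1/M.
  let r : NNReal := ⟨M⁻¹, inv_nonneg.2 hM.le⟩
  have hr0 : 0 < r := show (0 : ℝ) < M⁻¹ from inv_pos.2 hM
  have hr : (r : ENNReal) ≤ p.radius := by
    refine p.le_radius_of_bound 1 fun n => ?_
    rw [hp, FormalMultilinearSeries.ofScalars_norm]
    change ‖u n‖ * M⁻¹ ^ n ≤ 1
    rw [inv_pow, ← div_eq_mul_inv, div_le_one (by positivity)]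
    exact hu n
  have hpos : 0 < p.radius := lt_of_lt_of_le (ENNReal.coe_pos.2 hr0) hr
  have hf := p.hasFPowerSeriesOnBall hpos
  have hfa := hf.analyticAt
  refine ⟨p.sum, ⟨hfa, fun n => ?_⟩, ?_⟩
  · have h := (AnalyticAt.hasFPowerSeriesAt hfa).eq_formalMultilinearSeries hf.hasFPowerSeriesAt
    have h1 := congrFun (FormalMultilinearSeries.ofScalars_series_injective ℂ ℂ h) n
    rw [PowerSeries.coeff_mk, ← h1, mul_div_cancel₀ _ (cast_factorial_ne n)]
  · filter_upwards [Metric.eball_mem_nhds (0 : ℂ) hpos] with x hx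
    have := hf.hasSum hx
    simpa [hp, FormalMultilinearSeries.ofScalars_apply_eq, mul_comm] using this

end Taylor


/-! ### Comparison of coefficients in the ring of formal series. -/

section FormalSum

/-- The inclusion of the constants into `KernelRing`. -/
def constHom : ℂ →+* KernelRing := (MvPowerSeries.C).comp HahnSeries.C

lemma coeff_eval₂_mul_eval₂ (A B : ℂ[X]) (d : Fin 2 →₀ ℕ) :
    MvPowerSeries.coeff d (A.eval₂ constHom x₁ * B.eval₂ constHom x₂)
      = HahnSeries.C (A.coeff (d 0) * B.coeff (d 1)) := by
  induction A using Polynomial.induction_on' with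
  | add A A' hA hA' => rw [eval₂_add, add_mul, map_add, hA, hA', coeff_add, add_mul, map_add]
  | monomial m a =>
    induction B using Polynomial.induction_on' with
    | add B B' hB hB' => rw [eval₂_add, mul_add, map_add, hB, hB', coeff_add, mul_add, map_add]
    | monomial n b =>
      have hd : d = Finsupp.single 0 m + Finsupp.single 1 n ↔ m = d 0 ∧ n = d 1 := by
        rw [Finsupp.ext_iff, Fin.forall_fin_two]
        simp [eq_comm]
      rw [eval₂_monomial, eval₂_monomial, x₁, x₂, MvPowerSeries.X_pow_eq,
        MvPowerSeries.X_pow_eq, mul_mul_mul_comm, MvPowerSeries.monomial_mul_monomial,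
        ← map_mul, constHom, RingHom.comp_apply, MvPowerSeries.coeff_C_mul,
        MvPowerSeries.coeff_monomial, coeff_monomial, coeff_monomial]
      simp only [hd]
      by_cases hm : m = d 0 <;> by_cases hn : n = d 1 <;> simp [hm, hn]

lemma coeff_pow_mul_pow (i j : ℕ) (d : Fin 2 →₀ ℕ) :
    MvPowerSeries.coeff d ((x₁ * x₂) ^ i * ((x₁ - 1) * (x₂ - 1)) ^ j : KernelRing)
      = HahnSeries.C (xCoeff i j (d 0) * xCoeff i j (d 1)) := by
  rw [xCoeff, xCoeff, ← coeff_eval₂_mul_eval₂]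
  congr 1
  simp only [eval₂_mul, eval₂_pow, eval₂_X, eval₂_sub, eval₂_one, mul_pow]
  ring

/-- Here `PowerSeries.X` stands for 1/y: since (y-1)/y = 1 - 1/y, this is the negative binomial
series times y^(-k-1). -/
lemma inv_yVar_sub_one_pow (k : ℕ) :
    ((yVar - 1) ^ (k + 1))⁻¹ = HahnSeries.ofPowerSeries ℤ ℂ
      (PowerSeries.X ^ (k + 1) * PowerSeries.mk fun n => ((k + n).choose k : ℂ)) := by
  have h1 : (yVar - 1) * HahnSeries.ofPowerSeries ℤ ℂ PowerSeries.X
      = HahnSeries.ofPowerSeries ℤ ℂ (1 - PowerSeries.X) := by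
    rw [map_sub, map_one, HahnSeries.ofPowerSeries_X, yVar, sub_mul, one_mul,
      HahnSeries.single_mul_single]
    simp
  have h2 : (1 - PowerSeries.X : PowerSeries ℂ) ^ (k + 1)
      * PowerSeries.mk (fun n => ((k + n).choose k : ℂ)) = 1 := by
    rw [← PowerSeries.invOneSubPow_inv_eq_one_sub_pow,
      ← PowerSeries.invOneSubPow_val_succ_eq_mk_add_choose]
    exact (PowerSeries.invOneSubPow ℂ (k + 1)).inv_val
  refine inv_eq_of_mul_eq_one_right ?_
  rw [map_mul, map_pow, ← mul_assoc, ← mul_pow, h1, ← map_pow, ← map_mul, h2, map_one]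

lemma coeff_inv_yVar_sub_one_pow (k n : ℕ) :
    (((yVar - 1) ^ (k + 1))⁻¹).coeff ((n : ℤ) + 1) = (n.choose k : ℂ) := by
  rw [inv_yVar_sub_one_pow, ← Nat.cast_succ, HahnSeries.ofPowerSeries_apply_coeff,
    PowerSeries.coeff_X_pow_mul']
  split_ifs with h
  · rw [PowerSeries.coeff_mk]
    congr 2
    omega
  · rw [Nat.choose_eq_zero_of_lt (by omega), Nat.cast_zero]

lemma coeff_inv_yVar_sub_one_pow_of_nonpos (k : ℕ) {m : ℤ} (hm : m ≤ 0) :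
    (((yVar - 1) ^ (k + 1))⁻¹).coeff m = 0 := by
  rw [inv_yVar_sub_one_pow]
  rcases hm.eq_or_lt with rfl | h
  · rw [← Nat.cast_zero, HahnSeries.ofPowerSeries_apply_coeff, PowerSeries.coeff_X_pow_mul',
      if_neg (by omega)]
  · rw [HahnSeries.ofPowerSeries_apply, HahnSeries.embDomain_of_notMem_range]
    rintro ⟨n, hn⟩
    have : (n : ℤ) = m := hn
    omega

lemma coeff_tripleTerm (b₁ b₂ c₁ c₂ c₃ a₄ : ℂ) (i j k : ℕ) (d : Fin 2 →₀ ℕ) (m : ℤ) :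
    (MvPowerSeries.coeff d (tripleTerm b₁ b₂ c₁ c₂ c₃ a₄ i j k)).coeff m
      = tripleCoeff b₁ b₂ c₁ c₂ c₃ a₄ i j k * (xCoeff i j (d 0) * xCoeff i j (d 1))
        * (((yVar - 1) ^ (k + 1))⁻¹).coeff m := by
  rw [tripleTerm, mul_assoc, MvPowerSeries.coeff_C_mul, coeff_pow_mul_pow, div_eq_mul_inv,
    mul_right_comm, ← map_mul, HahnSeries.C_mul_eq_smul, HahnSeries.coeff_smul, smul_eq_mul]

lemma coeff_kernel (P : Module.Basis ℕ ℂ ℂ[X]) (d : Fin 2 →₀ ℕ) (m : ℤ) :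
    (MvPowerSeries.coeff d (kernel P)).coeff m
      = ∑ k ∈ (P.repr (P (d 0) * P (d 1))).support,
          if m = (k : ℤ) + 1 then structureConst P (d 0) (d 1) k else 0 := by
  change (∑ k ∈ (P.repr (P (d 0) * P (d 1))).support,
    HahnSeries.C (structureConst P (d 0) (d 1) k) * (yVar ^ (k + 1))⁻¹).coeff m = _
  rw [HahnSeries.coeff_sum]
  refine Finset.sum_congr rfl fun k _ => ?_
  have h : (yVar ^ (k + 1))⁻¹ = HahnSeries.single ((k : ℤ) + 1) 1 := by
    rw [yVar, HahnSeries.single_pow, HahnSeries.inv_single]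
    simp
  rw [h, HahnSeries.C_mul_eq_smul, HahnSeries.coeff_smul, HahnSeries.coeff_single, smul_eq_mul]
  split_ifs <;> simp

lemma coeff_kernel_succ (P : Module.Basis ℕ ℂ ℂ[X]) (d : Fin 2 →₀ ℕ) (n : ℕ) :
    (MvPowerSeries.coeff d (kernel P)).coeff ((n : ℤ) + 1)
      = structureConst P (d 0) (d 1) n := by
  rw [coeff_kernel]
  simp only [add_left_inj, Nat.cast_inj, Finset.sum_ite_eq]
  split_ifs with h
  · rfl
  · rw [structureConst, Finsupp.notMem_support_iff.1 h]

lemma coeff_kernel_of_nonpos (P : Module.Basis ℕ ℂ ℂ[X]) (d : Fin 2 →₀ ℕ) {m : ℤ} (hm : m ≤ 0) :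
    (MvPowerSeries.coeff d (kernel P)).coeff m = 0 := by
  rw [coeff_kernel]
  exact Finset.sum_eq_zero fun k _ => if_neg (by omega)

lemma isFormalSum_of_binomSum {b₁ b₂ c₁ c₂ c₃ a₄ : ℂ} {t : ℕ → ℕ → ℕ → ℂ}
    {P : Module.Basis ℕ ℂ ℂ[X]}
    (ht : ∀ i j k, j ≤ k → k ≤ i + j → tripleCoeff b₁ b₂ c₁ c₂ c₃ a₄ i j k = t i j k)
    (ht0 : ∀ i j k, k < j → t i j k = 0) (ht1 : ∀ i j k, i + j < k → t i j k = 0)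
    (hP : ∀ p s n, binomSum t p s n = structureConst P p s n) :
    IsFormalSum
      (fun u : TripleIndex => tripleTerm b₁ b₂ c₁ c₂ c₃ a₄ u.1.1 u.1.2.1 u.1.2.2) (kernel P) := by
  intro d m
  have hterm : ∀ u : TripleIndex,
      (MvPowerSeries.coeff d (tripleTerm b₁ b₂ c₁ c₂ c₃ a₄ u.1.1 u.1.2.1 u.1.2.2)).coeff m
      = t u.1.1 u.1.2.1 u.1.2.2
        * (xCoeff u.1.1 u.1.2.1 (d 0) * xCoeff u.1.1 u.1.2.1 (d 1))
        * (((yVar - 1) ^ (u.1.2.2 + 1))⁻¹).coeff m := fun u => by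
    rw [coeff_tripleTerm, ht _ _ _ u.2.1 u.2.2]
  simp only [hterm]
  rcases le_or_gt m 0 with hm | hm
  · simp only [coeff_inv_yVar_sub_one_pow_of_nonpos _ hm, coeff_kernel_of_nonpos _ _ hm,
      mul_zero, finsum_zero, ne_eq, not_true_eq_false, Set.ofPred_false, Set.finite_empty,
      and_self]
  -- The offset comes from the exponent k + 1 of 1/y in the kernel.
  obtain ⟨n, rfl⟩ : ∃ n : ℕ, m = n + 1 := ⟨(m - 1).toNat, by omega⟩
  simp only [coeff_inv_yVar_sub_one_pow, coeff_kernel_succ]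
  set F : ℕ × ℕ × ℕ → ℂ := fun u =>
    t u.1 u.2.1 u.2.2 * (xCoeff u.1 u.2.1 (d 0) * xCoeff u.1 u.2.1 (d 1)) * (n.choose u.2.2 : ℂ)
    with hF
  set S : Finset (ℕ × ℕ × ℕ) :=
    Finset.range (d 0 + 1) ×ˢ Finset.range (n + 1) ×ˢ Finset.range (n + 1) with hS
  -- Finiteness: x₁^i forces i ≤ d 0, the binomial coefficient forces k ≤ n, and j ≤ k.
  have hsupp : Function.support F ⊆ (S : Set (ℕ × ℕ × ℕ)) := by
    rintro ⟨i, j, k⟩ hu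
    have hu' : F (i, j, k) ≠ 0 := hu
    simp only [hF] at hu'
    have hi : ¬ d 0 < i := fun h => hu' (by rw [xCoeff_of_lt h]; ring)
    have hj : ¬ k < j := fun h => hu' (by rw [ht0 _ _ _ h]; ring)
    have hk : ¬ n < k := fun h => hu' (by rw [Nat.choose_eq_zero_of_lt h]; simp)
    simp only [hS, Finset.coe_product, Set.mem_prod, Finset.mem_coe, Finset.mem_range]
    omega
  constructor
  · exact (Set.Finite.subset S.finite_toSet hsupp).preimage Subtype.val_injective.injOn
  · change ∑ᶠ u : TripleIndex, F u.1 = _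
    have h1 : ∑ᶠ u : TripleIndex, F u.1
        = ∑ᶠ u ∈ {u : ℕ × ℕ × ℕ | u.2.1 ≤ u.2.2 ∧ u.2.2 ≤ u.1 + u.2.1}, F u :=
      finsum_set_coe_eq_finsum_mem _
    have h2 : Function.support F ⊆ {u : ℕ × ℕ × ℕ | u.2.1 ≤ u.2.2 ∧ u.2.2 ≤ u.1 + u.2.1} := by
      rintro ⟨i, j, k⟩ hu
      have hu' : F (i, j, k) ≠ 0 := hu
      simp only [hF] at hu'
      have hj : ¬ k < j := fun h => hu' (by rw [ht0 _ _ _ h]; ring)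
      have hk : ¬ i + j < k := fun h => hu' (by rw [ht1 _ _ _ h]; ring)
      simp only [Set.mem_ofPred_eq]
      omega
    rw [h1, ← finsum_mem_inter_support, Set.inter_eq_right.2 h2, finsum_mem_support,
      finsum_eq_sum_of_support_subset F hsupp, ← hP, binomSum, hS, Finset.sum_product]
    simp only [Finset.sum_product_right]
    rw [Finset.sum_comm]
    refine Finset.sum_congr rfl fun k hk => ?_
    rw [fullSum_eq_truncSum ht0 (Nat.lt_succ_self (d 0)) (Finset.mem_range.1 hk), truncSum,
      Finset.mul_sum]
    refine Finset.sum_congr rfl fun i _ => ?_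
    rw [Finset.mul_sum]
    exact Finset.sum_congr rfl fun j _ => mul_comm _ _

end FormalSum

/-! ### Existence and uniqueness of the normalized solution. -/

section Main

variable {a₁ a₂ a₃ a₄ a₅ a₆ b₁ b₂ c₁ c₂ c₃ : ℂ}

lemma exists_unique_normalizedSolution
    (hβ : ∀ n : ℕ, symbolDown a₁ a₃ n = (b₁ + n) * (b₂ + n))
    (hb₁ : ∀ n : ℕ, b₁ + (n : ℂ) ≠ 0) (hb₂ : ∀ n : ℕ, b₂ + (n : ℂ) ≠ 0) (lam : ℂ) {u : ℕ → ℂ}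
    (hu : ∀ n, seqOp (fun n => symbolDown a₁ a₃ n) (fun n => symbolMid a₁ a₂ a₄ n)
      (fun n => symbolUp a₂ a₅ a₆ n) u n + lam * u n = 0) (hu0 : u 0 = 1) :
    ∃ f : ℂ → ℂ, IsNormalizedSolution a₁ a₂ a₃ a₄ a₅ a₆ lam f ∧
      (∀ g : ℂ → ℂ, IsNormalizedSolution a₁ a₂ a₃ a₄ a₅ a₆ lam g → g =ᶠ[𝓝 0] f) ∧
      ∀ᶠ x in 𝓝 (0 : ℂ), HasSum (fun i : ℕ => u i * x ^ i) (f x) := by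
  have hne : ∀ n : ℕ, symbolDown a₁ a₃ n ≠ 0 := fun n => by
    rw [hβ]; exact mul_ne_zero (hb₁ n) (hb₂ n)
  obtain ⟨K₁, hK₁, h₁⟩ := exists_le_norm_add_natCast hb₁
  obtain ⟨K₂, hK₂, h₂⟩ := exists_le_norm_add_natCast hb₂
  have hKβ : ∀ n : ℕ, ((n : ℝ) + 1) ^ 2 ≤ K₁ * K₂ * ‖symbolDown a₁ a₃ n‖ := fun n => by
    rw [hβ, norm_mul]
    calc ((n : ℝ) + 1) ^ 2 = ((n : ℝ) + 1) * ((n : ℝ) + 1) := sq _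
      _ ≤ (K₁ * ‖b₁ + n‖) * (K₂ * ‖b₂ + n‖) :=
        mul_le_mul (h₁ n) (h₂ n) (by positivity) (by positivity)
      _ = _ := by ring
  -- The norms of the coefficients of `symbolMid` + λ, and below of `symbolUp`, as cubics in n.
  set A₁ := ‖lam‖ + ‖-4 - (a₁ - a₂) + a₄‖ + ‖6 + (a₁ - a₂)‖ + ‖(-2 : ℂ)‖
  set A₂ := ‖a₆‖ + ‖a₅ - a₂ + 2‖ + ‖a₂ - 3‖ + ‖(1 : ℂ)‖
  have hq : ∀ n : ℕ, ‖symbolMid a₁ a₂ a₄ n + lam‖ ≤ max A₁ A₂ * ((n : ℝ) + 1) ^ 3 := fun n => by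
    refine le_trans ?_ (mul_le_mul_of_nonneg_right (le_max_left A₁ A₂) (by positivity))
    refine le_trans (le_of_eq ?_) (norm_cubic_le _ _ _ _ n)
    simp only [symbolMid]
    congr 1
    ring
  have hγ : ∀ n : ℕ, ‖symbolUp a₂ a₅ a₆ n‖ ≤ max A₁ A₂ * ((n : ℝ) + 1) ^ 3 := fun n => by
    refine le_trans ?_ (mul_le_mul_of_nonneg_right (le_max_right A₁ A₂) (by positivity))
    refine le_trans (le_of_eq ?_) (norm_cubic_le _ _ _ _ n)
    simp only [symbolUp]
    congr 1
    ring
  obtain ⟨M, hM, hbound⟩ := exists_norm_le_pow hKβ hq hγ hu hu0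
  obtain ⟨f, hf, hsum⟩ := exists_hasTaylor_hasSum hM hbound
  have hcoeff : formalOp a₁ a₂ a₃ a₄ a₅ a₆ lam (PowerSeries.mk u) = 0 := by
    ext n
    rw [coeff_formalOp]
    simpa using hu n
  refine ⟨f, ⟨hf.1, ?_, ?_⟩, fun g hg => ?_, hsum⟩
  · rw [← hf.coeff_zero, PowerSeries.coeff_mk, hu0]
  · exact (hf.diffOp a₁ a₂ a₃ a₄ a₅ a₆ lam).eq_zero_iff.1 hcoeff
  · obtain ⟨G, hG⟩ := AnalyticAt.exists_hasTaylor hg.analyticAt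
    have hG0 := (hG.diffOp a₁ a₂ a₃ a₄ a₅ a₆ lam).eq_zero_iff.2 hg.diffOp_eq_zero
    have hGu : (fun n => PowerSeries.coeff n G) = u := by
      refine eq_of_seqOp_add_eq_zero hne (fun n => ?_) hu ?_
      · rw [← coeff_formalOp, hG0, map_zero]
      · rw [hG.coeff_zero, hg.map_zero, hu0]
    have hGF : G - PowerSeries.mk u = 0 := by
      rw [← hGu, sub_eq_zero]
      ext n
      simp
    filter_upwards [(hG.sub hf).eq_zero_iff.1 hGF] with x hx using sub_eq_zero.1 hx

end Main

end ThirdOrderKernel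

end

open ThirdOrderKernel

theorem theorem5p5p1
    (a₁ a₂ a₃ a₄ a₅ a₆ b₁ b₂ c₁ c₂ c₃ : ℂ)
    (hb_add : b₁ + b₂ = -a₁ - 1) (hb_mul : b₁ * b₂ = a₃)
    (hc_add : c₁ + c₂ + c₃ = a₂ - 3)
    (hc_mul₂ : c₁ * c₂ + c₁ * c₃ + c₂ * c₃ = a₅ - a₂ + 2)
    (hc_mul₃ : c₁ * c₂ * c₃ = a₆)
    (hb₁ : ∀ n : ℕ, b₁ + (n : ℂ) ≠ 0) (hb₂ : ∀ n : ℕ, b₂ + (n : ℂ) ≠ 0) :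
    ∃ P : Module.Basis ℕ ℂ ℂ[X],
      P 0 = 1 ∧ (∀ i : ℕ, (P i).natDegree = i) ∧
      (∀ lam : ℂ, ∃ f : ℂ → ℂ,
        ThirdOrderKernel.IsNormalizedSolution a₁ a₂ a₃ a₄ a₅ a₆ lam f ∧
        (∀ g : ℂ → ℂ, ThirdOrderKernel.IsNormalizedSolution a₁ a₂ a₃ a₄ a₅ a₆ lam g →
          g =ᶠ[𝓝 0] f) ∧
        ∀ᶠ x in 𝓝 (0 : ℂ), HasSum (fun i : ℕ => (P i).eval lam * x ^ i) (f x)) ∧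
      ThirdOrderKernel.IsFormalSum
        (fun t : ThirdOrderKernel.TripleIndex =>
          ThirdOrderKernel.tripleTerm b₁ b₂ c₁ c₂ c₃ a₄ t.1.1 t.1.2.1 t.1.2.2)
        (ThirdOrderKernel.kernel P) := by
  have hβ : ∀ n : ℕ, symbolDown a₁ a₃ n = (b₁ + n) * (b₂ + n) := fun n => by
    rw [symbolDown]
    linear_combination -hb_mul - (n : ℂ) * hb_add
  have hγ : ∀ n : ℕ, symbolUp a₂ a₅ a₆ n = (c₁ + n) * (c₂ + n) * (c₃ + n) := fun n => by
    rw [symbolUp]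
    linear_combination -hc_mul₃ - (n : ℂ) * hc_mul₂ - (n : ℂ) ^ 2 * hc_add
  have hφ : ∀ n : ℕ, symbolOne a₁ a₂ a₃ a₄ a₅ n
      = b₁ * b₂ + c₁ * c₂ + c₁ * c₃ + c₂ * c₃ + a₄ + (n : ℂ) * (c₁ + c₂ + c₃)
          + (1 - (n : ℂ)) * (b₁ + b₂) + (n : ℂ) ^ 2 - (n : ℂ) + 1 := fun n => by
    rw [symbolOne]
    linear_combination -hb_mul - hc_mul₂ - (n : ℂ) * hc_add - (1 - (n : ℂ)) * hb_add
  have hne : ∀ n : ℕ, symbolDown a₁ a₃ n ≠ 0 := fun n => by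
    rw [hβ]; exact mul_ne_zero (hb₁ n) (hb₂ n)
  refine ⟨recBasis (fun n => symbolMid a₁ a₂ a₄ n) (fun n => symbolUp a₂ a₅ a₆ n) hne,
    ?_, fun i => ?_, fun lam => ?_, ?_⟩
  · rw [recBasis_apply, recPoly]
  · rw [recBasis_apply]
    exact natDegree_eq_of_degree_eq_some (degree_recPoly hne i)
  · simp only [recBasis_apply]
    exact exists_unique_normalizedSolution hβ hb₁ hb₂ lam (seqOp_eval_recPoly hne lam)
      (by simp [recPoly])
  · refine isFormalSum_of_binomSum (t := opTriple a₁ a₂ a₃ a₄ a₅ a₆) (fun i j k h h' => ?_)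
      (fun i j k h => tripleSeq_of_lt h) (fun i j k h => tripleSeq_of_gt h) fun p s n => ?_
    · rw [tripleCoeff, opTriple, tripleSeq, if_pos ⟨h, h'⟩]
      simp only [hβ, hγ, hφ]
    -- For fixed s, both sides are arrays in (p, n) with the same equation and the same row p = 0.
    · refine congrFun (congrFun (eq_of_seqOp_eq_seqOpAdj hne
        (u := fun p n => binomSum (opTriple a₁ a₂ a₃ a₄ a₅ a₆) p s n)
        (fun p n => seqOp_binomSum_opTriple a₁ a₂ a₃ a₄ a₅ a₆ hne p s n)
        (fun p n => seqOp_structureConst hne p s n) ?_) p) n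
      funext n
      rw [structureConst_zero]
      exact binomSum_zero (fun j k => tripleSeq_zero_left j k) s n
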